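/- **Interior Carleman estimate with Lipschitz coefficients.** Write $D_j=-i\partial_j$, $D^\alpha=D_1^{\alpha_1}\cdots D_n^{\alpha_n}$, $K_R=\{x\in\mathbb R^n: |x_j|\le R,\ 1\le j\le n\}$ with interior $\overset{\circ}{K}_R$, and $|\cdot|$ for the Euclidean norm. For a complex $n\times n$ matrix $A=(A_{jl})$ put $p_A(\zeta)=\sum_{j,l}A_{jl}\zeta_j\zeta_l$, $\zeta\in\mathbb C^n$. A triple $(A,g,H)$, with $g\in\mathbb R^n$ and $H$ a real $n\times n$ matrix, is called *strongly pseudoconvex* if for all $\xi\in\mathbb R^n$, $\tau\in\mathbb R$, $$p_A(\xi+i\tau g)=0,\ (\xi,\tau)\neq(0,0)\ \Longrightarrow\ \operatorname{Re}\sum_{l,j=1}^n H_{lj}\,\partial_{\xi_j}p_A(\xi+i\tau g)\,\overline{\partial_{\xi_l}p_A(\xi+i\tau g)}>0$$ (for symmetric $H$ the sum is real). Let $\lambda,\Lambda,M_0>0$. Let $a=(a_{jl})$ be complex-valued coefficients such that for all $x,y\in K_1$, $1\le j,l\le n$ and $\xi\in\mathbb R^n$, $$a_{jl}(x)=a_{lj}(x),\quad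 |a_{jl}(x)|\le\Lambda,\quad |a_{jl}(x)-a_{jl}(y)|\le M_0|x-y|,\quad \Big|\sum_{j,l}a_{jl}(x)\xi_j\xi_l\Big|\ge\lambda|\xi|^2,$$ and let $P(x,D)=\sum_{j,l}a_{jl}(x)D_jD_l$. Let $\varphi\in C^2(K_1)$ be real-valued with $\nabla\varphi(x)\ne0$ for all $x\in K_1$, and suppose that $(a(0),\nabla\varphi(0),\nabla^2\varphi(0))$ is strongly pseudoconvex. Then there are $\bar R,\delta_0\in(0,1]$ and $C_0,\tau_0\ge1$ such that $$\sum_{|\alpha|\le2}\tau^{3-2|\alpha|}\int|D^\alpha u|^2e^{2\tau\varphi}\,dx\le C_0\int|P(\delta x,D)u|^2e^{2\tau\varphi}\,dx$$ for all complex-valued $u\in C_0^\infty(\overset{\circ}{K}_{\bar R})$, $\tau\ge\tau_0$ and $0<\delta\le\delta_0$. Moreover, the constants are uniform in the following sense. Let $\mathcal J$ be a compact set of strongly pseudoconvex triples and let $\omega:\mathbb R\to\mathbb R$ satisfy $\omega(r)\to0$ as $r\to0^+$. Then $\bar R,\delta_0,C_0,\tau_0$ can be chosen depending only on $n,\lambda,\Lambda,M_0,\mathcal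 J,\omega$ so that the estimate holds for all $a$ and $\varphi$ as above with $(a(0),\nabla\varphi(0),\nabla^2\varphi(0))\in\mathcal J$ and $|\partial^2_{jl}\varphi(x)-\partial^2_{jl}\varphi(0)|\le\omega(|x|)$ for all $x\in K_1\setminus\{0\}$ and all $j,l$. (The first assertion is the case in which $\mathcal J$ is a single triple and $\omega$ is a modulus of continuity of $\nabla^2\varphi$ at $0$.) -/

import Mathlib

namespace Carleman

/-- `ℝⁿ` with the Euclidean norm and Lebesgue measure. -/
abbrev E (n : ℕ) : Type := EuclideanSpace ℝ (Fin n)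

/-- The closed cube `K_R = {x : |x_j| ≤ R for all j}`. -/
def cube (n : ℕ) (R : ℝ) : Set (E n) := {x | ∀ j, |x j| ≤ R}

/-- The symbol `p(ζ) = ∑_{j,l} a_{jl} ζ_j ζ_l` of the homogeneous second order operator with
coefficient matrix `A = (a_{jl})`, as a function of `ζ ∈ ℂⁿ`. -/
noncomputable def symbol {n : ℕ} (A : Matrix (Fin n) (Fin n) ℂ) (ζ : Fin n → ℂ) : ℂ :=
  ∑ j, ∑ l, A j l * ζ j * ζ l

/-- The derivative `∂p/∂ξ_j` of the symbol at `ζ ∈ ℂⁿ`. -/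
noncomputable def symbolDeriv {n : ℕ} (A : Matrix (Fin n) (Fin n) ℂ) (j : Fin n)
    (ζ : Fin n → ℂ) : ℂ :=
  fderiv ℂ (symbol A) ζ (Pi.single j 1)

/-- The complex covector `ξ + i τ g`. -/
noncomputable def complexCovector {n : ℕ} (ξ g : E n) (τ : ℝ) : Fin n → ℂ :=
  fun j => (ξ j : ℂ) + Complex.I * (τ : ℂ) * (g j : ℂ)

/-- `S = ∑_{l,j} H_{lj} ∂_{ξ_j}p(ξ + iτg) * conj (∂_{ξ_l}p(ξ + iτg))`, where `p` is the symbol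
with coefficients `A`. With `A = a(y)`, `g = ∇φ(x)`, `H = ∇²φ(x)` this is `S(x, y; ξ, τ)`.
(For symmetric `H` the sum is real, so that nothing is lost by taking the real part.) -/
noncomputable def S {n : ℕ} (A : Matrix (Fin n) (Fin n) ℂ) (g : E n)
    (H : Matrix (Fin n) (Fin n) ℝ) (ξ : E n) (τ : ℝ) : ℝ :=
  (∑ l, ∑ j, (H l j : ℂ) * symbolDeriv A j (complexCovector ξ g τ) *
    (starRingEnd ℂ) (symbolDeriv A l (complexCovector ξ g τ))).re

/-- The strong pseudoconvexity condition at a point, for the coefficients `A`, the gradient `g`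
and the Hessian `H` of the weight there:
`p(ξ + iτg) = 0` and `(ξ, τ) ≠ (0, 0)` imply `S > 0`. -/
def StrongPseudoconvex {n : ℕ} (A : Matrix (Fin n) (Fin n) ℂ) (g : E n)
    (H : Matrix (Fin n) (Fin n) ℝ) : Prop :=
  ∀ (ξ : E n) (τ : ℝ), (ξ, τ) ≠ (0, 0) → symbol A (complexCovector ξ g τ) = 0 → 0 < S A g H ξ τ

/-- The assumptions on the coefficients on the cube `K_1`: symmetry, boundedness, Lipschitz
continuity and ellipticity. -/
structure AdmissibleCoeff {n : ℕ} (lam Lam M₀ : ℝ) (a : E n → Matrix (Fin n) (Fin n) ℂ) :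
    Prop where
  symm : ∀ x ∈ cube n 1, ∀ j l, a x j l = a x l j
  bdd : ∀ x ∈ cube n 1, ∀ j l, ‖a x j l‖ ≤ Lam
  lip : ∀ x ∈ cube n 1, ∀ y ∈ cube n 1, ∀ j l, ‖a x j l - a y j l‖ ≤ M₀ * ‖x - y‖
  elliptic : ∀ x ∈ cube n 1, ∀ ξ : E n, lam * ‖ξ‖ ^ 2 ≤ ‖symbol (a x) (fun j => (ξ j : ℂ))‖

/-- The gradient of a function on the cube `K_1` (one-sided at the boundary). -/
noncomputable def grad {n : ℕ} (φ : E n → ℝ) (x : E n) : E n :=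
  gradientWithin φ (cube n 1) x

/-- The Hessian `(∂²_{jl} φ(x))` of a function on the cube `K_1` (one-sided at the boundary). -/
noncomputable def hess {n : ℕ} (φ : E n → ℝ) (x : E n) : Matrix (Fin n) (Fin n) ℝ :=
  fun j l => iteratedFDerivWithin ℝ 2 φ (cube n 1) x
    ![EuclideanSpace.single j 1, EuclideanSpace.single l 1]

/-- `D_j = -i ∂_j`. -/
noncomputable def D {n : ℕ} (j : Fin n) (u : E n → ℂ) : E n → ℂ :=
  fun x => -Complex.I * fderiv ℝ u x (EuclideanSpace.single j 1)

/-- `D^α = D_1^{α_1} ⋯ D_n^{α_n}` for a multi-index `α`. -/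
noncomputable def Dpow {n : ℕ} (α : Fin n → ℕ) (u : E n → ℂ) : E n → ℂ :=
  (List.finRange n).foldr (fun j v => (D j)^[α j] v) u

/-- `P(δx, D)u (x) = ∑_{j,l} a_{jl}(δx) D_j D_l u(x)`. -/
noncomputable def P {n : ℕ} (a : E n → Matrix (Fin n) (Fin n) ℂ) (δ : ℝ) (u : E n → ℂ) :
    E n → ℂ :=
  fun x => ∑ j, ∑ l, a (δ • x) j l * D j (D l u) x

end Carleman

/-!
The proof conjugates the operator with `e^{τφ}`, computes a commutator, and compares everything with
the constant data `A = a(0)`, `g = ∇φ(0)`, `H = ∇²φ(0)`.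

For `v = e^{τφ} u` one has `e^{τφ} ∑ a_{jl} D_j D_l u = L v` with `L = ∑ a_{jl} X_j X_l` and
`X_j = D_j + i τ ∂_jφ` (`X_exp_mul`). The formal adjoint of `X_j` is the same operator for the
weight `-φ`, and the two commute up to `2τ ∇²φ`. Hence moving all derivatives in `‖L v‖²`
to the other side gives `‖L' v‖²`, with `L'` the principal part of the adjoint, plus the integral of
an explicit density, which is therefore at most `‖L v‖²` (`re_integral_commDensity_le`).

If the coefficients and the gradient and Hessian of the weight are constant, Plancherel's theorem
turns the integral of the density into that of `2τ S(ξ, τ) |v̂(ξ)|²`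
(`hasSpectralForm_frozenDensity`). Strong pseudoconvexity, ellipticity, homogeneity and compactness
give a constant `C`, uniform over the compact set of triples, with
`|ξ|⁴ + τ²|ξ|² + τ⁴ ≤ C τ² S + C² |p(ξ + iτg)|²` (`exists_symbol_estimate`). Thus the second order
jet of `v`, with `τ` counted as a derivative, is controlled by the frozen form and the frozen
operator (`integral_jetSq_le_frozen`).

On a small cube, with `δ` small, the variable data are `η`-close to the frozen ones: the Hessian of
`φ` by means of `ω`, and the coefficients `a(δ ·)` because their Lipschitz constant is `M₀ δ`. All
differences between variable and frozen expressions are bounded pointwise by `η` times the jet, with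
the power of `τ` of the main term (`near_commDensity`), so they are absorbed
(`exists_integral_jetSq_le`). No partition of unity is needed, since the frozen data live at one
point only.

The commutator computation needs smooth data, but the constants in the resulting estimate depend on
no norm of the data beyond their `η`-closeness to the frozen ones. Mollification keeps the Lipschitz constant of the coefficients and converges
in `C²` for the weight, while the final inequality contains only `a` and `φ` themselves, without
derivatives; so it passes to the limit (`carleman_of_forall_approx`, `exists_dataNear_approx`).
-/

namespace Carleman

open MeasureTheory Complex Filter Topology
open scoped ContDiff ComplexConjugate FourierTransform NNReal Convolution

variable {n : ℕ}

/-! ### Conjugated derivatives -/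

theorem two_le_infty : (2 : WithTop ℕ∞) ≤ ∞ :=
  WithTop.coe_le_coe.2 le_top

/-- Complex-valued smooth functions with compact support. -/
structure IsTest (f : E n → ℂ) : Prop where
  smooth : ContDiff ℝ ∞ f
  supp : HasCompactSupport f

/-- The partial derivative `∂_j ψ`. -/
noncomputable def pd (j : Fin n) (ψ : E n → ℝ) : E n → ℝ :=
  fun x => fderiv ℝ ψ x (EuclideanSpace.single j 1)

/-- The conjugated derivative `X_j = D_j + i (∂_j ψ) = e^ψ D_j e^{-ψ}`. Its formal adjoint is the
same operator for the weight `-ψ`. -/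
noncomputable def X (ψ : E n → ℝ) (j : Fin n) (f : E n → ℂ) : E n → ℂ :=
  fun x => D j f x + I * (pd j ψ x : ℂ) * f x

theorem contDiff_D {f : E n → ℂ} (hf : ContDiff ℝ ∞ f) (j : Fin n) : ContDiff ℝ ∞ (D j f) := by
  unfold D
  exact contDiff_const.mul ((hf.fderiv_right (m := ∞) (by simp)).clm_apply contDiff_const)

theorem contDiff_pd {ψ : E n → ℝ} (hψ : ContDiff ℝ ∞ ψ) (j : Fin n) : ContDiff ℝ ∞ (pd j ψ) := by
  unfold pd
  exact (hψ.fderiv_right (m := ∞) (by simp)).clm_apply contDiff_const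

theorem pd_neg (j : Fin n) (ψ : E n → ℝ) (x : E n) : pd j (-ψ) x = -pd j ψ x := by
  simp [pd, fderiv_neg]

theorem contDiff_neg {ψ : E n → ℝ} (hψ : ContDiff ℝ ∞ ψ) : ContDiff ℝ ∞ (-ψ) := hψ.neg

theorem contDiff_ofReal_comp {ψ : E n → ℝ} {k : WithTop ℕ∞} (hψ : ContDiff ℝ k ψ) :
    ContDiff ℝ k (fun x => (ψ x : ℂ)) :=
  ofRealCLM.contDiff.comp hψ

theorem contDiff_conj_comp {f : E n → ℂ} {k : WithTop ℕ∞} (hf : ContDiff ℝ k f) :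
    ContDiff ℝ k (fun x => conj (f x)) :=
  conjCLE.contDiff.comp hf

namespace IsTest

variable {f g : E n → ℂ}

theorem differentiable (hf : IsTest f) : Differentiable ℝ f :=
  hf.smooth.differentiable (by simp)

theorem continuous (hf : IsTest f) : Continuous f := hf.smooth.continuous

theorem integrable (hf : IsTest f) : Integrable f :=
  hf.continuous.integrable_of_hasCompactSupport hf.supp

theorem D (hf : IsTest f) (j : Fin n) : IsTest (D j f) :=
  ⟨contDiff_D hf.smooth j, by
    unfold Carleman.D
    exact (hf.supp.fderiv_apply (𝕜 := ℝ) _).mul_left⟩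

theorem mul_left {c : E n → ℂ} (hc : ContDiff ℝ ∞ c) (hf : IsTest f) :
    IsTest (fun x => c x * f x) :=
  ⟨hc.mul hf.smooth, hf.supp.mul_left⟩

theorem mul_right {c : E n → ℂ} (hf : IsTest f) (hc : ContDiff ℝ ∞ c) :
    IsTest (fun x => f x * c x) :=
  ⟨hf.smooth.mul hc, hf.supp.mul_right⟩

theorem conjugate (hf : IsTest f) : IsTest (fun x => conj (f x)) :=
  ⟨contDiff_conj_comp hf.smooth, hf.supp.comp_left (map_zero _)⟩

theorem add (hf : IsTest f) (hg : IsTest g) : IsTest (fun x => f x + g x) :=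
  ⟨hf.smooth.add hg.smooth, hf.supp.add hg.supp⟩

theorem X {ψ : E n → ℝ} (hψ : ContDiff ℝ ∞ ψ) (hf : IsTest f) (j : Fin n) : IsTest (X ψ j f) :=
  (hf.D j).add (hf.mul_left (contDiff_const.mul (contDiff_ofReal_comp (contDiff_pd hψ j))))

theorem sum {ι : Type*} {s : Finset ι} {F : ι → E n → ℂ} (h : ∀ i ∈ s, IsTest (F i)) :
    IsTest (fun x => ∑ i ∈ s, F i x) := by
  classical
  induction s using Finset.induction_on with
  | empty =>
    simp only [Finset.sum_empty]
    exact ⟨contDiff_const, HasCompactSupport.zero⟩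
  | insert i s hi ih =>
    simp only [Finset.sum_insert hi]
    exact (h i (by simp)).add (ih fun k hk => h k (by simp [hk]))

end IsTest

theorem D_mul {c f : E n → ℂ} (hc : Differentiable ℝ c) (hf : Differentiable ℝ f) (j : Fin n)
    (x : E n) : D j (fun y => c y * f y) x = D j c x * f x + c x * D j f x := by
  unfold D
  rw [fderiv_fun_mul (hc x) (hf x)]
  simp
  ring

theorem D_add {f g : E n → ℂ} (hf : Differentiable ℝ f) (hg : Differentiable ℝ g) (j : Fin n)
    (x : E n) : D j (fun y => f y + g y) x = D j f x + D j g x := by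
  unfold D
  rw [fderiv_fun_add (hf x) (hg x)]
  simp
  ring

theorem D_const_mul {f : E n → ℂ} (hf : Differentiable ℝ f) (c : ℂ) (j : Fin n)
    (x : E n) : D j (fun y => c * f y) x = c * D j f x := by
  unfold D
  rw [fderiv_const_mul (hf x)]
  simp
  ring

theorem D_ofReal {ψ : E n → ℝ} (hψ : Differentiable ℝ ψ) (j : Fin n) (x : E n) :
    D j (fun y => (ψ y : ℂ)) x = -I * (pd j ψ x : ℂ) := by
  unfold D pd
  have : HasFDerivAt (fun y => (ψ y : ℂ)) (ofRealCLM.comp (fderiv ℝ ψ x)) x :=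
    ofRealCLM.hasFDerivAt.comp x (hψ x).hasFDerivAt
  rw [this.fderiv]
  simp

theorem D_conj {f : E n → ℂ} (hf : Differentiable ℝ f) (j : Fin n) (x : E n) :
    D j (fun y => conj (f y)) x = -conj (D j f x) := by
  unfold D
  have : HasFDerivAt (fun y => conj (f y)) ((conjCLE : ℂ →L[ℝ] ℂ).comp (fderiv ℝ f x)) x :=
    (conjCLE : ℂ →L[ℝ] ℂ).hasFDerivAt.comp x (hf x).hasFDerivAt
  rw [this.fderiv]
  simp

theorem fderiv_comm {F : Type*} [NormedAddCommGroup F] [NormedSpace ℝ F] {f : E n → F}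
    (hf : ContDiff ℝ 2 f) (x v w : E n) :
    fderiv ℝ (fun y => fderiv ℝ f y v) x w = fderiv ℝ (fun y => fderiv ℝ f y w) x v := by
  have hd : DifferentiableAt ℝ (fderiv ℝ f) x :=
    (hf.fderiv_right (m := 1) (by norm_num)).differentiable (by simp) x
  have h : ∀ v w : E n, fderiv ℝ (fun y => fderiv ℝ f y v) x w = fderiv ℝ (fderiv ℝ f) x w v := by
    intro v w
    have := (hd.hasFDerivAt.clm_apply (hasFDerivAt_const v x)).fderiv
    rw [this]; simp
  rw [h, h]
  exact ((hf.contDiffAt).isSymmSndFDerivAt (by simp)).eq w v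

theorem pd_comm {ψ : E n → ℝ} (hψ : ContDiff ℝ ∞ ψ) (j k : Fin n) (x : E n) :
    pd j (pd k ψ) x = pd k (pd j ψ) x :=
  fderiv_comm (hψ.of_le two_le_infty) _ _ _

theorem D_comm {f : E n → ℂ} (hf : ContDiff ℝ ∞ f) (j k : Fin n) (x : E n) :
    D j (D k f) x = D k (D j f) x := by
  have h2 : ContDiff ℝ 2 f := hf.of_le two_le_infty
  have hd : ∀ v : E n, DifferentiableAt ℝ (fun y => fderiv ℝ f y v) x := fun v =>
    (((h2.fderiv_right (m := 1) (by norm_num)).clm_apply contDiff_const).differentiable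
      (by simp)) x
  unfold D
  rw [fderiv_const_mul (hd _), fderiv_const_mul (hd _)]
  simp [fderiv_comm h2 x (EuclideanSpace.single j 1) (EuclideanSpace.single k 1)]

/-- The weights of the two factors are independent, because products with the weights `ψ` and `-ψ`
are both needed. -/
theorem X_X_apply {ψ χ : E n → ℝ} (hχ : ContDiff ℝ ∞ χ) {f : E n → ℂ}
    (hf : IsTest f) (j k : Fin n) (x : E n) :
    X ψ j (X χ k f) x = D j (D k f) x + pd j (pd k χ) x * f x + I * pd k χ x * D j f x
      + I * pd j ψ x * D k f x - pd j ψ x * pd k χ x * f x := by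
  have h1 : Differentiable ℝ (D k f) := (hf.D k).differentiable
  have h2 : Differentiable ℝ (pd k χ) := (contDiff_pd hχ k).differentiable (by simp)
  have h3 : Differentiable ℝ (fun x => (pd k χ x : ℂ)) :=
    (contDiff_ofReal_comp (contDiff_pd hχ k)).differentiable (by simp)
  have h4 : Differentiable ℝ (fun x => I * (pd k χ x : ℂ)) := h3.const_mul I
  change D j (fun y => D k f y + I * (pd k χ y : ℂ) * f y) x
    + I * (pd j ψ x : ℂ) * (D k f x + I * (pd k χ x : ℂ) * f x) = _
  rw [D_add h1 (h4.fun_mul hf.differentiable), D_mul h4 hf.differentiable, D_const_mul h3,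
    D_ofReal h2]
  ring_nf
  simp
  ring

/-- The conjugated derivatives for the weights `ψ` and `-ψ` commute up to twice the Hessian. -/
theorem X_neg_X_comm {ψ : E n → ℝ} (hψ : ContDiff ℝ ∞ ψ) {f : E n → ℂ}
    (hf : IsTest f) (j k : Fin n) (x : E n) :
    X (-ψ) j (X ψ k f) x = X ψ k (X (-ψ) j f) x + 2 * pd j (pd k ψ) x * f x := by
  have hn : ∀ j, pd j (-ψ) = -pd j ψ := fun j => funext (pd_neg j ψ)
  rw [X_X_apply hψ hf, X_X_apply (contDiff_neg hψ) hf, D_comm hf.smooth, hn, pd_neg, pd_comm hψ j k]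
  simp
  ring

theorem integral_D_mul_conj {f g : E n → ℂ} (hf : IsTest f) (hg : IsTest g) (j : Fin n) :
    ∫ x, D j f x * conj (g x) = ∫ x, f x * conj (D j g x) := by
  have hc := hg.conjugate
  have key : ∫ x, f x * fderiv ℝ (fun y => conj (g y)) x (EuclideanSpace.single j 1)
      = -∫ x, fderiv ℝ f x (EuclideanSpace.single j 1) * conj (g x) := by
    have hI : ∀ {p : E n → ℂ}, ContDiff ℝ ∞ p →
        Continuous fun x => fderiv ℝ p x (EuclideanSpace.single j 1) := fun hp =>
      ((hp.fderiv_right (m := ∞) (by simp)).clm_apply contDiff_const).continuous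
    refine integral_mul_fderiv_eq_neg_fderiv_mul_of_integrable ?_ ?_ ?_
      (fun x _ => hf.differentiable x) (fun x _ => hc.differentiable x)
    · exact ((hI hf.smooth).mul hc.continuous).integrable_of_hasCompactSupport hc.supp.mul_left
    · exact (hf.continuous.mul (hI hc.smooth)).integrable_of_hasCompactSupport hf.supp.mul_right
    · exact (hf.continuous.mul hc.continuous).integrable_of_hasCompactSupport hf.supp.mul_right
  have e1 : ∀ x, conj (D j g x) = I * fderiv ℝ (fun y => conj (g y)) x
      (EuclideanSpace.single j 1) := by
    intro x
    have h := D_conj hg.differentiable j x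
    rw [← neg_eq_iff_eq_neg] at h
    rw [← h]; simp [D]
  simp only [e1]
  simp only [D, mul_assoc, mul_left_comm _ I, integral_const_mul, key]
  ring

/-- The formal adjoint of `X_j` for the weight `ψ` is `X_j` for the weight `-ψ`. -/
theorem integral_X_mul_conj {ψ : E n → ℝ} (hψ : ContDiff ℝ ∞ ψ) {f g : E n → ℂ}
    (hf : IsTest f) (hg : IsTest g) (j : Fin n) :
    ∫ x, X ψ j f x * conj (g x) = ∫ x, f x * conj (X (-ψ) j g x) := by
  have hcd : ContDiff ℝ ∞ (fun x => I * (pd j ψ x : ℂ)) :=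
    contDiff_const.mul (contDiff_ofReal_comp (contDiff_pd hψ j))
  have i1 := ((hf.D j).mul_right (hg.conjugate).smooth).integrable
  have i2 := ((hf.mul_left hcd).mul_right hg.conjugate.smooth).integrable
  have i3 := (hf.mul_right (hg.D j).conjugate.smooth).integrable
  calc ∫ x, X ψ j f x * conj (g x)
      = ∫ x, (D j f x * conj (g x) + I * (pd j ψ x : ℂ) * f x * conj (g x)) := by
        simp only [X, add_mul]
    _ = (∫ x, D j f x * conj (g x)) + ∫ x, I * (pd j ψ x : ℂ) * f x * conj (g x) :=
        integral_add i1 i2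
    _ = (∫ x, f x * conj (D j g x)) + ∫ x, I * (pd j ψ x : ℂ) * f x * conj (g x) := by
        rw [integral_D_mul_conj hf hg]
    _ = ∫ x, (f x * conj (D j g x) + I * (pd j ψ x : ℂ) * f x * conj (g x)) :=
        (integral_add i3 i2).symm
    _ = _ := by
        congr 1; ext x
        simp [X, pd_neg]
        ring

/-- Moving two conjugated derivatives across the scalar product with a variable coefficient `c`.
The commutator contributes the Hessian of the weight; the derivatives of `c` are the error. -/
theorem integral_swap {ψ : E n → ℝ} (hψ : ContDiff ℝ ∞ ψ) {c f h : E n → ℂ}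
    (hc : ContDiff ℝ ∞ c) (hf : IsTest f) (hh : IsTest h) (j k : Fin n) :
    ∫ x, c x * X ψ j f x * conj (X ψ k h x)
      = (∫ x, c x * X (-ψ) k f x * conj (X (-ψ) j h x))
        + ∫ x, (2 * c x * pd j (pd k ψ) x * f x * conj (h x)
          - D j c x * f x * conj (X ψ k h x) + D k c x * f x * conj (X (-ψ) j h x)) := by
  have hcf := hf.mul_left hc
  have hX : ∀ {ψ : E n → ℝ} (_ : ContDiff ℝ ∞ ψ) (p : E n → ℂ) (_ : IsTest p) (j : Fin n) (x : E n),
      X ψ j (fun y => c y * p y) x = D j c x * p x + c x * X ψ j p x := by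
    intro ψ hψ p hp j x
    simp only [X]
    rw [D_mul (hc.differentiable (by simp)) hp.differentiable]
    ring
  have t1 := (hf.mul_left (contDiff_D hc j)).mul_right (hh.X hψ k).conjugate.smooth
  have t2 := (hf.mul_left (contDiff_D hc k)).mul_right (hh.X (contDiff_neg hψ) j).conjugate.smooth
  have t3 := hcf.mul_right ((hh.X hψ k).X (contDiff_neg hψ) j).conjugate.smooth
  have t4 := hcf.mul_right ((hh.X (contDiff_neg hψ) j).X hψ k).conjugate.smooth
  have t5 : IsTest fun x => 2 * c x * pd j (pd k ψ) x * f x * conj (h x) :=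
    (hf.mul_left ((contDiff_const.mul hc).mul
      (contDiff_ofReal_comp (contDiff_pd (contDiff_pd hψ k) j)))).mul_right hh.conjugate.smooth
  have t6 := ((hf.X (contDiff_neg hψ) k).mul_left hc).mul_right
    (hh.X (contDiff_neg hψ) j).conjugate.smooth
  have t7 := ((hf.X hψ j).mul_left hc).mul_right (hh.X hψ k).conjugate.smooth
  -- Move `X_j` to the right, commute it with `X_k`, and move `X_k` back to the left.
  have e1 : ∫ x, c x * X ψ j f x * conj (X ψ k h x)
      = (∫ x, c x * f x * conj (X (-ψ) j (X ψ k h) x)) - ∫ x, D j c x * f x * conj (X ψ k h x) := by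
    rw [← integral_X_mul_conj hψ hcf (hh.X hψ k) j, ← integral_sub]
    · congr 1; ext x; rw [hX hψ f hf]; ring
    · exact ((hcf.X hψ j).mul_right (hh.X hψ k).conjugate.smooth).integrable
    · exact t1.integrable
  have e2 : ∫ x, c x * f x * conj (X (-ψ) j (X ψ k h) x)
      = (∫ x, c x * f x * conj (X ψ k (X (-ψ) j h) x))
        + ∫ x, 2 * c x * pd j (pd k ψ) x * f x * conj (h x) := by
    rw [← integral_add t4.integrable t5.integrable]
    congr 1; ext x; rw [X_neg_X_comm hψ hh]
    simp only [map_add, map_mul, conj_ofReal, map_ofNat]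
    ring
  have e3 : ∫ x, c x * f x * conj (X ψ k (X (-ψ) j h) x)
      = (∫ x, c x * X (-ψ) k f x * conj (X (-ψ) j h x))
        + ∫ x, D k c x * f x * conj (X (-ψ) j h x) := by
    have := integral_X_mul_conj (contDiff_neg hψ) hcf (hh.X (contDiff_neg hψ) j) k
    rw [neg_neg] at this
    rw [← this, ← integral_add t6.integrable t2.integrable]
    congr 1; ext x; rw [hX (contDiff_neg hψ) f hf]; ring
  have e4 := integral_add (t5.integrable.sub t1.integrable) t2.integrable
  rw [integral_sub' t5.integrable t1.integrable] at e4
  simp only [Pi.sub_apply] at e4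
  rw [e1, e2, e3, e4]
  ring

/-! ### The commutator identity -/

/-- The density left over when the four conjugated derivatives in
`∫ c X_j X_l v conj (X_k X_m v)` are moved to the other side of the product. The first four terms
contain the Hessian of the weight, the last four a derivative of `c`. For `ψ = τ φ`, with `τ`
counted as a derivative, every term has total order three, so it is bounded by `τ⁻¹` times the
square of the second order jet of `v`. -/
noncomputable def commDensity (ψ : E n → ℝ) (c v : E n → ℂ) (j l k m : Fin n) (x : E n) : ℂ :=
  2 * c x * pd j (pd k ψ) x * X ψ l v x * conj (X ψ m v x)
    + 2 * c x * pd k (pd l ψ) x * v x * conj (X (-ψ) j (X ψ m v) x)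
    + 2 * c x * pd j (pd m ψ) x * X ψ l (X (-ψ) k v) x * conj (v x)
    + 2 * c x * pd l (pd m ψ) x * X (-ψ) k v x * conj (X (-ψ) j v x)
    - D j c x * X ψ l v x * conj (X ψ k (X ψ m v) x)
    + D k c x * X ψ l v x * conj (X (-ψ) j (X ψ m v) x)
    - D l c x * X (-ψ) k v x * conj (X ψ m (X (-ψ) j v) x)
    + D m c x * X (-ψ) k v x * conj (X (-ψ) l (X (-ψ) j v) x)

section

variable {ψ : E n → ℝ} {c v : E n → ℂ}

theorem contDiff_ofReal_pd_pd (hψ : ContDiff ℝ ∞ ψ) (j k : Fin n) :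
    ContDiff ℝ ∞ (fun x => (pd j (pd k ψ) x : ℂ)) :=
  contDiff_ofReal_comp (contDiff_pd (contDiff_pd hψ k) j)

theorem isTest_commDensity (hψ : ContDiff ℝ ∞ ψ) (hc : ContDiff ℝ ∞ c) (hv : IsTest v)
    (j l k m : Fin n) : IsTest (commDensity ψ c v j l k m) := by
  have hn := contDiff_neg hψ
  have hp := contDiff_ofReal_pd_pd hψ
  have h2 : ContDiff ℝ ∞ (fun x => 2 * c x) := contDiff_const.mul hc
  have hneg : ∀ {f : E n → ℂ}, IsTest f → IsTest (fun x => -f x) := fun hf => by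
    simpa using hf.mul_left (c := fun _ => -1) contDiff_const
  have hD : ∀ {p q : E n → ℂ} (i : Fin n), IsTest p → IsTest q →
      IsTest (fun x => D i c x * p x * conj (q x)) := fun i h h' =>
    (h.mul_left (contDiff_D hc i)).mul_right h'.conjugate.smooth
  have hH : ∀ {p q : E n → ℂ} (i i' : Fin n), IsTest p → IsTest q →
      IsTest (fun x => 2 * c x * pd i (pd i' ψ) x * p x * conj (q x)) := fun i i' h h' =>
    (h.mul_left (h2.mul (hp i i'))).mul_right h'.conjugate.smooth
  unfold commDensity
  simp only [sub_eq_add_neg]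
  exact (((((((hH j k (hv.X hψ l) (hv.X hψ m)).add
    (hH k l hv ((hv.X hψ m).X hn j))).add
    (hH j m ((hv.X hn k).X hψ l) hv)).add
    (hH l m (hv.X hn k) (hv.X hn j))).add
    (hneg (hD j (hv.X hψ l) ((hv.X hψ m).X hψ k)))).add
    (hD k (hv.X hψ l) ((hv.X hψ m).X hn j))).add
    (hneg (hD l (hv.X hn k) ((hv.X hn j).X hψ m)))).add
    (hD m (hv.X hn k) ((hv.X hn j).X hn l))

/-- The commutator identity for one pair of coefficients, `c = a_{jl} conj a_{km}`: all four
derivatives change sides, in two applications of `integral_swap`. -/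
theorem integral_quadratic (hψ : ContDiff ℝ ∞ ψ) (hc : ContDiff ℝ ∞ c) (hv : IsTest v)
    (j l k m : Fin n) :
    ∫ x, c x * X ψ j (X ψ l v) x * conj (X ψ k (X ψ m v) x)
      = (∫ x, c x * X (-ψ) m (X (-ψ) k v) x * conj (X (-ψ) l (X (-ψ) j v) x))
        + ∫ x, commDensity ψ c v j l k m x := by
  have hn := contDiff_neg hψ
  have hp := contDiff_ofReal_pd_pd hψ
  have h2 : ContDiff ℝ ∞ (fun x => 2 * c x) := contDiff_const.mul hc
  have hD : ∀ {p q : E n → ℂ} (i : Fin n), IsTest p → IsTest q →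
      Integrable (fun x => D i c x * p x * conj (q x)) := fun i h h' =>
    ((h.mul_left (contDiff_D hc i)).mul_right h'.conjugate.smooth).integrable
  have hH : ∀ {p q : E n → ℂ} (i i' : Fin n), IsTest p → IsTest q →
      Integrable (fun x => 2 * c x * pd i (pd i' ψ) x * p x * conj (q x)) := fun i i' h h' =>
    ((h.mul_left (h2.mul (hp i i'))).mul_right h'.conjugate.smooth).integrable
  have hC : ∀ {p q : E n → ℂ}, IsTest p → IsTest q →
      Integrable (fun x => c x * p x * conj (q x)) := fun h h' =>
    ((h.mul_left hc).mul_right h'.conjugate.smooth).integrable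
  have s1 := integral_swap hψ hc (hv.X hψ l) (hv.X hψ m) j k
  have s2 := integral_swap hψ hc (hv.X hn k) (hv.X hn j) l m
  have e : ∫ x, c x * X (-ψ) k (X ψ l v) x * conj (X (-ψ) j (X ψ m v) x)
      = (∫ x, c x * X ψ l (X (-ψ) k v) x * conj (X ψ m (X (-ψ) j v) x))
        + ∫ x, (2 * c x * pd k (pd l ψ) x * v x * conj (X (-ψ) j (X ψ m v) x)
          + 2 * c x * pd j (pd m ψ) x * X ψ l (X (-ψ) k v) x * conj (v x)) := by
    have i : Integrable fun x => 2 * c x * pd k (pd l ψ) x * v x * conj (X (-ψ) j (X ψ m v) x)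
          + 2 * c x * pd j (pd m ψ) x * X ψ l (X (-ψ) k v) x * conj (v x) :=
      (hH k l hv ((hv.X hψ m).X hn j)).add (hH j m ((hv.X hn k).X hψ l) hv)
    rw [← integral_add (hC ((hv.X hn k).X hψ l) ((hv.X hn j).X hψ m)) i]
    congr 1; ext x
    simp only [X_neg_X_comm hψ hv]
    simp only [map_add, map_mul, conj_ofReal, map_ofNat]
    ring
  rw [s1, e, s2, add_assoc, add_assoc, ← integral_add, ← integral_add]
  · congr 2; ext x; simp only [commDensity]; ring
  · exact ((hH l m (hv.X hn k) (hv.X hn j)).sub (hD l (hv.X hn k) ((hv.X hn j).X hψ m))).add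
      (hD m (hv.X hn k) ((hv.X hn j).X hn l))
  · exact ((hH k l hv ((hv.X hψ m).X hn j)).add (hH j m ((hv.X hn k).X hψ l) hv)).add
      ((hH j k (hv.X hψ l) (hv.X hψ m)).sub (hD j (hv.X hψ l) ((hv.X hψ m).X hψ k)) |>.add
        (hD k (hv.X hψ l) ((hv.X hψ m).X hn j)))
  · exact (hH k l hv ((hv.X hψ m).X hn j)).add (hH j m ((hv.X hn k).X hψ l) hv)
  · exact ((hH j k (hv.X hψ l) (hv.X hψ m)).sub (hD j (hv.X hψ l) ((hv.X hψ m).X hψ k))).add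
      (hD k (hv.X hψ l) ((hv.X hψ m).X hn j))

end

/-- The conjugated operator `∑ a_{jl} X_j X_l`, the sum running over the pairs `(j, l)`. -/
noncomputable def conjOp (ψ : E n → ℝ) (a : Fin n × Fin n → E n → ℂ) (v : E n → ℂ) : E n → ℂ :=
  fun x => ∑ p : Fin n × Fin n, a p x * X ψ p.1 (X ψ p.2 v) x

theorem ofReal_norm_sq (z : ℂ) : ((‖z‖ ^ 2 : ℝ) : ℂ) = z * conj z := by
  rw [mul_conj, normSq_eq_norm_sq]

theorem IsTest.integrable_norm_sq {f : E n → ℂ} (hf : IsTest f) :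
    Integrable (fun x => ‖f x‖ ^ 2) := by
  refine (hf.mul_right hf.conjugate.smooth).integrable.norm.congr (ae_of_all _ fun x => ?_)
  simp [sq]

theorem integral_sum_sum {ι : Type*} [Fintype ι] {F : ι → ι → E n → ℂ}
    (hF : ∀ p q, Integrable (F p q)) :
    ∫ x, ∑ p, ∑ q, F p q x = ∑ p, ∑ q, ∫ x, F p q x := by
  have h1 : ∀ p, Integrable fun x => ∑ q, F p q x := fun p =>
    integrable_finsetSum _ fun q _ => hF p q
  rw [integral_finsetSum _ fun p _ => h1 p]
  exact Finset.sum_congr rfl fun p _ => integral_finsetSum _ fun q _ => hF p q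

/-- The commutator method: for `L = ∑ a_{jl} X_j X_l` and the principal part `L'` of its adjoint,
`‖L v‖² - ‖L' v‖²` is the integral of the commutator density, so that this integral is at most
`‖L v‖²`. -/
theorem re_integral_commDensity_le {ψ : E n → ℝ} {a : Fin n × Fin n → E n → ℂ}
    {v : E n → ℂ} (hψ : ContDiff ℝ ∞ ψ) (ha : ∀ p, ContDiff ℝ ∞ (a p)) (hv : IsTest v) :
    (∫ x, ∑ p : Fin n × Fin n, ∑ q : Fin n × Fin n,
      commDensity ψ (fun y => a p y * conj (a q y)) v p.1 p.2 q.1 q.2 x).re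
      ≤ ∫ x, ‖conjOp ψ a v x‖ ^ 2 := by
  have hn := contDiff_neg hψ
  have hc : ∀ p q, ContDiff ℝ ∞ (fun y => a p y * conj (a q y)) := fun p q =>
    (ha p).mul (contDiff_conj_comp (ha q))
  have e1 : ((∫ x, ‖conjOp ψ a v x‖ ^ 2 : ℝ) : ℂ)
      = ∑ p : Fin n × Fin n, ∑ q : Fin n × Fin n, ∫ x, (a p x * conj (a q x))
          * X ψ p.1 (X ψ p.2 v) x * conj (X ψ q.1 (X ψ q.2 v) x) := by
    rw [← integral_complex_ofReal, ← integral_sum_sum]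
    · congr 1; ext x
      rw [ofReal_norm_sq, conjOp, map_sum, Finset.sum_mul_sum]
      refine Finset.sum_congr rfl fun p _ => Finset.sum_congr rfl fun q _ => ?_
      rw [map_mul]
      ring
    · exact fun p q => ((((hv.X hψ p.2).X hψ p.1).mul_left (hc p q)).mul_right
        ((hv.X hψ q.2).X hψ q.1).conjugate.smooth).integrable
  have e2 : ((∫ x, ‖∑ q : Fin n × Fin n, conj (a q x) * X (-ψ) q.2 (X (-ψ) q.1 v) x‖ ^ 2 : ℝ) : ℂ)
      = ∑ p : Fin n × Fin n, ∑ q : Fin n × Fin n, ∫ x, (a p x * conj (a q x))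
          * X (-ψ) q.2 (X (-ψ) q.1 v) x * conj (X (-ψ) p.2 (X (-ψ) p.1 v) x) := by
    rw [← integral_complex_ofReal, ← integral_sum_sum]
    · congr 1; ext x
      rw [ofReal_norm_sq, map_sum, mul_comm, Finset.sum_mul_sum]
      refine Finset.sum_congr rfl fun p _ => Finset.sum_congr rfl fun q _ => ?_
      rw [map_mul, conj_conj]
      ring
    · exact fun p q => ((((hv.X hn q.1).X hn q.2).mul_left (hc p q)).mul_right
        ((hv.X hn p.1).X hn p.2).conjugate.smooth).integrable
  have e3 : ((∫ x, ‖conjOp ψ a v x‖ ^ 2 : ℝ) : ℂ)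
      = ((∫ x, ‖∑ q : Fin n × Fin n, conj (a q x) * X (-ψ) q.2 (X (-ψ) q.1 v) x‖ ^ 2 : ℝ) : ℂ)
      + ∫ x, ∑ p : Fin n × Fin n, ∑ q : Fin n × Fin n,
        commDensity ψ (fun y => a p y * conj (a q y)) v p.1 p.2 q.1 q.2 x := by
    rw [e1, e2, integral_sum_sum]
    · simp only [← Finset.sum_add_distrib]
      exact Finset.sum_congr rfl fun p _ => Finset.sum_congr rfl fun q _ =>
        integral_quadratic hψ (hc p q) hv _ _ _ _
    · exact fun p q => (isTest_commDensity hψ (hc p q) hv _ _ _ _).integrable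
  have e4 := congrArg Complex.re e3
  rw [add_re, ofReal_re, ofReal_re] at e4
  rw [e4]
  have : 0 ≤ ∫ x, ‖∑ q : Fin n × Fin n, conj (a q x) * X (-ψ) q.2 (X (-ψ) q.1 v) x‖ ^ 2 :=
    integral_nonneg fun x => by positivity
  linarith

/-! ### Freezing the coefficients and the weight -/

/-- `x` and `y` have size at most `B` and differ by at most `η B`. These relations with a common
relative error `η` are stable under sums and products. -/
def Near (η B : ℝ) (x y : ℂ) : Prop := ‖x‖ ≤ B ∧ ‖y‖ ≤ B ∧ ‖x - y‖ ≤ η * B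

namespace Near

variable {η B B' : ℝ} {x y x' y' : ℂ}

theorem nonneg (h : Near η B x y) : 0 ≤ B := (norm_nonneg x).trans h.1

theorem mono (hη : 0 ≤ η) (h : Near η B x y) (hB : B ≤ B') : Near η B' x y :=
  ⟨h.1.trans hB, h.2.1.trans hB, h.2.2.trans (mul_le_mul_of_nonneg_left hB hη)⟩

theorem refl (hη : 0 ≤ η) (h : ‖x‖ ≤ B) : Near η B x x :=
  ⟨h, h, by simpa using mul_nonneg hη ((norm_nonneg x).trans h)⟩

theorem zero_right (hη : η ≤ 1) (hB : 0 ≤ B) (h : ‖x‖ ≤ η * B) : Near η B x 0 :=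
  ⟨h.trans (mul_le_of_le_one_left hB hη), by simpa using hB, by simpa using h⟩

theorem add (h : Near η B x y) (h' : Near η B' x' y') : Near η (B + B') (x + x') (y + y') := by
  refine ⟨(norm_add_le _ _).trans (add_le_add h.1 h'.1),
    (norm_add_le _ _).trans (add_le_add h.2.1 h'.2.1), ?_⟩
  rw [show x + x' - (y + y') = (x - y) + (x' - y') by ring, mul_add]
  exact (norm_add_le _ _).trans (add_le_add h.2.2 h'.2.2)

theorem neg (h : Near η B x y) : Near η B (-x) (-y) := by
  refine ⟨by simpa using h.1, by simpa using h.2.1, ?_⟩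
  rw [show -x - -y = -(x - y) by ring, norm_neg]
  exact h.2.2

theorem sub (h : Near η B x y) (h' : Near η B' x' y') : Near η (B + B') (x - x') (y - y') := by
  simpa [sub_eq_add_neg] using h.add h'.neg

theorem mul (h : Near η B x y) (h' : Near η B' x' y') :
    Near η (2 * B * B') (x * x') (y * y') := by
  have hB := h.nonneg
  have hB' := h'.nonneg
  have hBB := mul_nonneg hB hB'
  refine ⟨?_, ?_, ?_⟩
  · rw [norm_mul]
    nlinarith [mul_le_mul h.1 h'.1 (norm_nonneg _) hB]
  · rw [norm_mul]
    nlinarith [mul_le_mul h.2.1 h'.2.1 (norm_nonneg _) hB]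
  · rw [show x * x' - y * y' = (x - y) * x' + y * (x' - y') by ring]
    refine (norm_add_le _ _).trans ?_
    rw [norm_mul, norm_mul]
    have h1 := mul_le_mul h.2.2 h'.1 (norm_nonneg _) ((norm_nonneg _).trans h.2.2)
    have h2 := mul_le_mul h.2.1 h'.2.2 (norm_nonneg _) hB
    linarith

/-- Multiplication by a fixed scalar of size at most one. -/
theorem unit_mul {u : ℂ} (hu : ‖u‖ ≤ 1) (h : Near η B x y) : Near η B (u * x) (u * y) := by
  have aux : ∀ z : ℂ, ‖u * z‖ ≤ ‖z‖ := fun z => by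
    rw [norm_mul]; exact mul_le_of_le_one_left (norm_nonneg z) hu
  refine ⟨(aux _).trans h.1, (aux _).trans h.2.1, ?_⟩
  rw [← mul_sub]
  exact (aux _).trans h.2.2

theorem conjugate (h : Near η B x y) : Near η B (conj x) (conj y) := by
  refine ⟨by simpa using h.1, by simpa using h.2.1, ?_⟩
  rw [← map_sub, RCLike.norm_conj]
  exact h.2.2

theorem sum {ι : Type*} {s : Finset ι} {f g : ι → ℂ} (h : ∀ i ∈ s, Near η B (f i) (g i)) :
    Near η (s.card * B) (∑ i ∈ s, f i) (∑ i ∈ s, g i) := by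
  classical
  induction s using Finset.induction_on with
  | empty => simp [Near]
  | insert i s hi ih =>
    rw [Finset.sum_insert hi, Finset.sum_insert hi, Finset.card_insert_of_notMem hi]
    have := (h i (by simp)).add (ih fun k hk => h k (by simp [hk]))
    convert this using 1
    push_cast
    ring

end Near

/-- Pointwise bounds for the derivatives of `v` up to second order, each derivative having the
weight of one factor of the large parameter `τ`. -/
structure JetBound (F τ : ℝ) (v : E n → ℂ) (x : E n) : Prop where
  zero : ‖v x‖ ≤ F / τ ^ 2
  one : ∀ j, ‖D j v x‖ ≤ F / τ
  two : ∀ j l, ‖D j (D l v) x‖ ≤ F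

/-- At the point `x` the gradient of the weight `ψ` is close to the gradient of the affine
weight `χ`, at the scale `τ`. The Hessian of `ψ` is only bounded: in `X_j X_k v` it is of lower
order. -/
structure WeightNear (η K τ : ℝ) (ψ χ : E n → ℝ) (x : E n) : Prop where
  grad : ∀ j, Near η (K * τ) (pd j ψ x : ℂ) (pd j χ x : ℂ)
  hess : ∀ j k, |pd j (pd k ψ) x| ≤ K * τ
  flat : ∀ j k, pd j (pd k χ) x = 0

theorem WeightNear.neg {η K τ : ℝ} {ψ χ : E n → ℝ} {x : E n} (h : WeightNear η K τ ψ χ x) :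
    WeightNear η K τ (-ψ) (-χ) x := by
  have hn : ∀ (ψ : E n → ℝ) j, pd j (-ψ) = -pd j ψ := fun ψ j => funext (pd_neg j ψ)
  refine ⟨fun j => ?_, fun j k => ?_, fun j k => ?_⟩
  · rw [pd_neg, pd_neg]; push_cast; exact (h.grad j).neg
  · rw [hn, pd_neg, abs_neg]; exact h.hess j k
  · rw [hn, pd_neg, h.flat, neg_zero]

section

variable {η K F τ : ℝ} {ψ χ ψ' χ' : E n → ℝ} {v : E n → ℂ} {x : E n}

theorem near_X (hη : 0 ≤ η) (hK : 1 ≤ K) (hF : 0 ≤ F) (hτ : 0 < τ) (hv : JetBound F τ v x)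
    (hw : WeightNear η K τ ψ χ x) (j : Fin n) :
    Near η (3 * K * F / τ) (X ψ j v x) (X χ j v x) := by
  have h := (Near.refl hη (hv.one j)).add
    (((hw.grad j).unit_mul (u := I) (by simp)).mul (Near.refl hη hv.zero))
  refine h.mono hη ?_
  have h1 : 2 * (K * τ) * (F / τ ^ 2) = 2 * K * (F / τ) := by field_simp
  have h2 : 0 ≤ F / τ := by positivity
  rw [h1, show 3 * K * F / τ = 3 * K * (F / τ) by ring]
  nlinarith

theorem near_X_X (hη : 0 ≤ η) (hη1 : η ≤ 1) (hK : 1 ≤ K) (hF : 0 ≤ F) (hτ : 0 < τ)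
    (hτη : 1 / τ ≤ η) (hψ' : ContDiff ℝ ∞ ψ') (hχ' : ContDiff ℝ ∞ χ') (htest : IsTest v)
    (hv : JetBound F τ v x) (hw : WeightNear η K τ ψ χ x) (hw' : WeightNear η K τ ψ' χ' x)
    (j k : Fin n) :
    Near η (20 * K ^ 2 * F) (X ψ j (X ψ' k v) x) (X χ j (X χ' k v) x) := by
  rw [X_X_apply hψ' htest, X_X_apply hχ' htest, hw'.flat]
  have hI : ‖I‖ ≤ 1 := by simp
  -- The Hessian of the weight only multiplies `v` itself and is of relative size `1 / τ`.
  have hh : Near η (K * F) ((pd j (pd k ψ') x : ℂ) * v x) (((0 : ℝ) : ℂ) * v x) := by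
    rw [ofReal_zero, zero_mul]
    refine Near.zero_right hη1 (by positivity) ?_
    rw [norm_mul, norm_real]
    calc |pd j (pd k ψ') x| * ‖v x‖ ≤ (K * τ) * (F / τ ^ 2) :=
          mul_le_mul (hw'.hess j k) hv.zero (norm_nonneg _) (by positivity)
      _ = 1 / τ * (K * F) := by field_simp
      _ ≤ η * (K * F) := by gcongr
  have h := ((((Near.refl hη (hv.two j k)).add hh).add
    (((hw'.grad k).unit_mul hI).mul (Near.refl hη (hv.one j)))).add
    (((hw.grad j).unit_mul hI).mul (Near.refl hη (hv.one k)))).sub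
    (((hw.grad j).mul (hw'.grad k)).mul (Near.refl hη hv.zero))
  refine h.mono hη ?_
  have h1 : 2 * (K * τ) * (F / τ) = 2 * (K * F) := by field_simp
  have h2 : 2 * (2 * (K * τ) * (K * τ)) * (F / τ ^ 2) = 4 * (K ^ 2 * F) := by field_simp; ring
  rw [h1, h2]
  have h3 : K * F ≤ K ^ 2 * F := by gcongr; nlinarith
  have h4 : F ≤ K ^ 2 * F := le_mul_of_one_le_left hF (one_le_pow₀ hK)
  have h5 : 0 ≤ K ^ 2 * F := by positivity
  linarith

/-- The commutator density with the coefficient `c`, the gradient of the weight and `τ⁻¹` times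
its Hessian replaced by constants. The Hessian is transposed here to match the order of the indices
in `S`. -/
noncomputable def frozenDensity (τ : ℝ) (H : Matrix (Fin n) (Fin n) ℝ) (χ : E n → ℝ) (c : ℂ)
    (v : E n → ℂ) (j l k m : Fin n) (x : E n) : ℂ :=
  2 * c * (τ * H k j : ℝ) * X χ l v x * conj (X χ m v x)
    + 2 * c * (τ * H k l : ℝ) * v x * conj (X (-χ) j (X χ m v) x)
    + 2 * c * (τ * H m j : ℝ) * X χ l (X (-χ) k v) x * conj (v x)
    + 2 * c * (τ * H m l : ℝ) * X (-χ) k v x * conj (X (-χ) j v x)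

/-- The commutator density is close to the frozen one, with an error that has the small factor `η`
in front of `F² / τ`. The terms with a derivative of `c` contribute only to the error. -/
theorem near_commDensity {c : E n → ℂ} {c₀ : ℂ} {H : Matrix (Fin n) (Fin n) ℝ}
    (hη : 0 ≤ η) (hη1 : η ≤ 1) (hK : 1 ≤ K) (hF : 0 ≤ F) (hτ : 0 < τ)
    (hτη : 1 / τ ≤ η) (hψ : ContDiff ℝ ∞ ψ) (hχ : ContDiff ℝ ∞ χ) (htest : IsTest v)
    (hv : JetBound F τ v x) (hw : WeightNear η K τ ψ χ x)
    (hH : ∀ j k, Near η (K * τ) (pd j (pd k ψ) x : ℂ) (τ * H j k : ℝ))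
    (hc : Near η (2 * K ^ 2) (c x) c₀) (hDc : ∀ i, ‖D i c x‖ ≤ η * (2 * K ^ 2))
    (j l k m : Fin n) :
    Near η (10000 * K ^ 5 * (F ^ 2 / τ)) (commDensity ψ c v j l k m x)
      (frozenDensity τ H χ c₀ v j l k m x) := by
  have hn := contDiff_neg hψ
  have hnχ := contDiff_neg hχ
  have hH' : ∀ j k, Near η (K * τ) (pd j (pd k ψ) x : ℂ) (τ * H k j : ℝ) := fun j k => by
    rw [pd_comm hψ]; exact hH k j
  have hc2 : Near η (4 * K ^ 2) (2 * c x) (2 * c₀) := by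
    have := hc.add hc
    rw [← two_mul, ← two_mul, ← two_mul] at this
    convert this using 1
    ring
  have hD0 : ∀ i, Near η (2 * K ^ 2) (D i c x) 0 := fun i =>
    Near.zero_right hη1 (by positivity) (hDc i)
  have p1 := near_X hη hK hF hτ hv hw
  have m1 := near_X hη hK hF hτ hv hw.neg
  have v0 : Near η (F / τ ^ 2) (v x) (v x) := Near.refl hη hv.zero
  have pp := near_X_X hη hη1 hK hF hτ hτη hψ hχ htest hv hw hw
  have mp := near_X_X hη hη1 hK hF hτ hτη hψ hχ htest hv hw.neg hw
  have pm := near_X_X hη hη1 hK hF hτ hτη hn hnχ htest hv hw hw.neg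
  have mm := near_X_X hη hη1 hK hF hτ hτη hn hnχ htest hv hw.neg hw.neg
  have e : frozenDensity τ H χ c₀ v j l k m x
      = 2 * c₀ * (τ * H k j : ℝ) * X χ l v x * conj (X χ m v x)
        + 2 * c₀ * (τ * H k l : ℝ) * v x * conj (X (-χ) j (X χ m v) x)
        + 2 * c₀ * (τ * H m j : ℝ) * X χ l (X (-χ) k v) x * conj (v x)
        + 2 * c₀ * (τ * H m l : ℝ) * X (-χ) k v x * conj (X (-χ) j v x)
        - 0 * X χ l v x * conj (X χ k (X χ m v) x)
        + 0 * X χ l v x * conj (X (-χ) j (X χ m v) x)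
        - 0 * X (-χ) k v x * conj (X χ m (X (-χ) j v) x)
        + 0 * X (-χ) k v x * conj (X (-χ) l (X (-χ) j v) x) := by
    unfold frozenDensity; ring
  rw [e]
  -- The factors are compared one by one; the constants of the eight terms add up to 3776.
  refine ((((((((((hc2.mul (hH' j k)).mul (p1 l)).mul (p1 m).conjugate).add
    (((hc2.mul (hH k l)).mul v0).mul (mp j m).conjugate)).add
    (((hc2.mul (hH' j m)).mul (pm l k)).mul v0.conjugate)).add
    (((hc2.mul (hH' l m)).mul (m1 k)).mul (m1 j).conjugate)).sub
    (((hD0 j).mul (p1 l)).mul (pp k m).conjugate)).add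
    (((hD0 k).mul (p1 l)).mul (mp j m).conjugate)).sub
    (((hD0 l).mul (m1 k)).mul (pm m j).conjugate)).add
    (((hD0 m).mul (m1 k)).mul (mm l j).conjugate)).mono hη ?_
  set W := K ^ 5 * (F ^ 2 / τ) with hW
  have hW0 : 0 ≤ W := by positivity
  have e1 : 2 * (2 * (2 * (4 * K ^ 2) * (K * τ)) * (3 * K * F / τ)) * (3 * K * F / τ)
      = 288 * W := by rw [hW]; field_simp; ring
  have e2 : 2 * (2 * (2 * (4 * K ^ 2) * (K * τ)) * (F / τ ^ 2)) * (20 * K ^ 2 * F)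
      = 640 * W := by rw [hW]; field_simp; ring
  have e3 : 2 * (2 * (2 * (4 * K ^ 2) * (K * τ)) * (20 * K ^ 2 * F)) * (F / τ ^ 2)
      = 640 * W := by rw [hW]; field_simp; ring
  have e4 : 2 * (2 * (2 * K ^ 2) * (3 * K * F / τ)) * (20 * K ^ 2 * F)
      = 480 * W := by rw [hW]; field_simp; ring
  rw [e1, e2, e3, e4, mul_assoc]
  linarith

end

/-- The affine weight `τ ⟨g, x⟩`. -/
noncomputable def linWeight (τ : ℝ) (g : E n) (x : E n) : ℝ := τ * inner ℝ g x

theorem contDiff_linWeight (τ : ℝ) (g : E n) : ContDiff ℝ ∞ (linWeight τ g) :=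
  contDiff_const.mul (contDiff_const.inner ℝ contDiff_id)

theorem pd_linWeight (τ : ℝ) (g : E n) (j : Fin n) (x : E n) :
    pd j (linWeight τ g) x = τ * g j := by
  have : HasFDerivAt (linWeight τ g) (τ • innerSL ℝ g) x :=
    ((innerSL ℝ g).hasFDerivAt).const_mul τ
  rw [pd, this.fderiv]
  simp [EuclideanSpace.inner_single_right]

theorem pd_pd_linWeight (τ : ℝ) (g : E n) (j k : Fin n) (x : E n) :
    pd j (pd k (linWeight τ g)) x = 0 := by
  have : pd k (linWeight τ g) = fun _ => τ * g k := funext (pd_linWeight τ g k)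
  rw [this]
  simp [pd]

/-! ### The symbol inequality -/

theorem symbolDeriv_eq (A : Matrix (Fin n) (Fin n) ℂ) (hA : ∀ j l, A j l = A l j) (j : Fin n)
    (ζ : Fin n → ℂ) : symbolDeriv A j ζ = 2 * ∑ l, A j l * ζ l := by
  have h : HasFDerivAt (symbol A) (∑ k, ∑ l, ((A k l * ζ k) • ContinuousLinearMap.proj l
      + (ζ l) • (A k l) • ContinuousLinearMap.proj (R := ℂ) (φ := fun _ : Fin n => ℂ) k)) ζ := by
    unfold symbol
    refine HasFDerivAt.fun_sum fun k _ => HasFDerivAt.fun_sum fun l _ => ?_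
    exact ((hasFDerivAt_apply k ζ).const_mul (A k l)).mul (hasFDerivAt_apply l ζ)
  rw [symbolDeriv, h.fderiv]
  simp only [sum_apply, add_apply,
    smul_apply, ContinuousLinearMap.proj_apply, smul_eq_mul,
    Finset.sum_add_distrib, Pi.single_apply, mul_ite, mul_one, mul_zero, Finset.sum_ite_eq',
    Finset.mem_univ, if_true]
  have e : (∑ k, ∑ l, if k = j then ζ l * A k l else 0) = ∑ l, ζ l * A j l := by
    rw [Finset.sum_comm]
    simp
  rw [e, two_mul]
  congr 1
  · exact Finset.sum_congr rfl fun l _ => by rw [hA]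
  · exact Finset.sum_congr rfl fun l _ => mul_comm _ _

/-- On a compact set, positivity of `f` on the zero set of `h ≥ 0` gives a quantitative bound. With
the square in front of `h`, the sets on which the bound holds for a given `m` increase with `m`. -/
theorem _root_.IsCompact.exists_one_le_mul_add_sq_mul {Y : Type*} [TopologicalSpace Y] {K : Set Y}
    (hK : IsCompact K) {f h : Y → ℝ} (hf : Continuous f) (hh : Continuous h)
    (h0 : ∀ x ∈ K, 0 ≤ h x) (hpos : ∀ x ∈ K, h x = 0 → 0 < f x) :
    ∃ m : ℝ, 1 ≤ m ∧ ∀ x ∈ K, 1 ≤ m * f x + m ^ 2 * h x := by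
  let U : ℕ → Set Y := fun m => {x | 1 < ((m : ℝ) + 1) * f x + ((m : ℝ) + 1) ^ 2 * h x}
  have hU : ∀ m, IsOpen (U m) := fun m =>
    isOpen_lt continuous_const ((continuous_const.mul hf).add (continuous_const.mul hh))
  have hcov : K ⊆ ⋃ m, U m := by
    intro x hx
    rw [Set.mem_iUnion]
    rcases (h0 x hx).eq_or_lt with hx0 | hx0
    · have hfx := hpos x hx hx0.symm
      obtain ⟨m, hm⟩ := exists_nat_gt (1 / f x)
      refine ⟨m, ?_⟩
      rw [div_lt_iff₀ hfx] at hm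
      simp only [U, Set.mem_ofPred_eq, ← hx0]
      nlinarith
    · obtain ⟨m, hm⟩ := exists_nat_gt ((2 + |f x|) / h x)
      refine ⟨m, ?_⟩
      rw [div_lt_iff₀ hx0] at hm
      simp only [U, Set.mem_ofPred_eq]
      have h1 := neg_abs_le (f x)
      have h2 : (0 : ℝ) ≤ m := Nat.cast_nonneg m
      have h3 : 1 < f x + ((m : ℝ) + 1) * h x := by nlinarith
      nlinarith
  have hmono : ∀ i k : ℕ, i ≤ k → K ∩ U i ⊆ U k := by
    rintro i k hik x ⟨hxK, hx⟩
    simp only [U, Set.mem_ofPred_eq] at hx ⊢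
    have h1 : (i : ℝ) + 1 ≤ k + 1 := by exact_mod_cast Nat.succ_le_succ hik
    have h2 : (0 : ℝ) < i + 1 := by positivity
    have h3 := h0 x hxK
    have h4 : 0 < f x + ((i : ℝ) + 1) * h x := by
      by_contra hcon
      nlinarith
    calc 1 < ((i : ℝ) + 1) * (f x + ((i : ℝ) + 1) * h x) := by linarith
      _ ≤ ((k : ℝ) + 1) * (f x + ((i : ℝ) + 1) * h x) := by gcongr
      _ ≤ ((k : ℝ) + 1) * (f x + ((k : ℝ) + 1) * h x) := by gcongr
      _ = _ := by ring
  obtain ⟨t, ht⟩ := hK.elim_finite_subcover U hU hcov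
  refine ⟨(t.sup id : ℕ) + 1, by simp, fun x hx => ?_⟩
  obtain ⟨i, hi, hxi⟩ := Set.mem_iUnion₂.1 (ht hx)
  exact le_of_lt (hmono i _ (Finset.le_sup (f := id) hi) ⟨hx, hxi⟩)

theorem complexCovector_smul (ξ g : E n) (τ t : ℝ) :
    complexCovector (t • ξ) g (t * τ) = (t : ℂ) • complexCovector ξ g τ := by
  ext j
  simp [complexCovector]
  ring

theorem symbol_smul (A : Matrix (Fin n) (Fin n) ℂ) (t : ℂ) (ζ : Fin n → ℂ) :
    symbol A (t • ζ) = t ^ 2 * symbol A ζ := by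
  simp only [symbol, Pi.smul_apply, smul_eq_mul, Finset.mul_sum]
  refine Finset.sum_congr rfl fun j _ => Finset.sum_congr rfl fun l _ => by ring

/-- The quadratic form `S` with the derivatives of the symbol written out, which is legitimate for a
symmetric coefficient matrix. -/
noncomputable def formS (A : Matrix (Fin n) (Fin n) ℂ) (g : E n) (H : Matrix (Fin n) (Fin n) ℝ)
    (ξ : E n) (τ : ℝ) : ℝ :=
  (∑ k, ∑ j, (H k j : ℂ) * (2 * ∑ l, A j l * complexCovector ξ g τ l) *
    conj (2 * ∑ m, A k m * complexCovector ξ g τ m)).re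

theorem S_eq_formS {A : Matrix (Fin n) (Fin n) ℂ} (hA : ∀ j l, A j l = A l j) (g : E n)
    (H : Matrix (Fin n) (Fin n) ℝ) (ξ : E n) (τ : ℝ) : S A g H ξ τ = formS A g H ξ τ := by
  simp only [S, formS, symbolDeriv_eq A hA]

theorem formS_smul (A : Matrix (Fin n) (Fin n) ℂ) (g : E n) (H : Matrix (Fin n) (Fin n) ℝ)
    (ξ : E n) (τ t : ℝ) : formS A g H (t • ξ) (t * τ) = t ^ 2 * formS A g H ξ τ := by
  unfold formS
  rw [← re_ofReal_mul, Finset.mul_sum]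
  refine congrArg Complex.re (Finset.sum_congr rfl fun k _ => ?_)
  refine Eq.trans ?_ (Finset.mul_sum _ _ _).symm
  simp only [complexCovector_smul, Pi.smul_apply, smul_eq_mul]
  refine Finset.sum_congr rfl fun j _ => ?_
  have e : ∀ i : Fin n, (∑ l, A i l * ((t : ℂ) * complexCovector ξ g τ l))
      = t * ∑ l, A i l * complexCovector ξ g τ l := fun i => by
    rw [Finset.mul_sum]
    exact Finset.sum_congr rfl fun l _ => by ring
  rw [e, e]
  simp only [map_mul, conj_ofReal]
  push_cast
  ring

/-- Strong pseudoconvexity on a compact set of elliptic triples, in quantitative form. The factor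
`τ ^ 2` makes the right-hand side homogeneous; it kills the first term at `τ = 0`, where it is
ellipticity that makes the right-hand side positive. -/
theorem exists_symbol_estimate {lam : ℝ} (hlam : 0 < lam)
    {J : Set (Matrix (Fin n) (Fin n) ℂ × E n × Matrix (Fin n) (Fin n) ℝ)} (hJ : IsCompact J)
    (hSP : ∀ A g H, (A, g, H) ∈ J → StrongPseudoconvex A g H)
    (hsymm : ∀ A g H, (A, g, H) ∈ J → ∀ j l, A j l = A l j)
    (hell : ∀ A g H, (A, g, H) ∈ J →
      ∀ ξ : E n, lam * ‖ξ‖ ^ 2 ≤ ‖symbol A (fun j => (ξ j : ℂ))‖) :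
    ∃ C : ℝ, 1 ≤ C ∧ ∀ A g H, (A, g, H) ∈ J → ∀ (ξ : E n) (τ : ℝ),
      ‖ξ‖ ^ 4 + τ ^ 2 * ‖ξ‖ ^ 2 + τ ^ 4
        ≤ C * (τ ^ 2 * formS A g H ξ τ) + C ^ 2 * ‖symbol A (complexCovector ξ g τ)‖ ^ 2 := by
  let Sph : Set (E n × ℝ) := {q | ‖q.1‖ ^ 2 + q.2 ^ 2 = 1}
  have hSph : IsCompact Sph := by
    refine Metric.isCompact_of_isClosed_isBounded ?_ ?_
    · exact isClosed_eq (by fun_prop) continuous_const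
    · refine (Metric.isBounded_closedBall (x := (0 : E n × ℝ)) (r := 1)).subset fun q hq => ?_
      simp only [Sph, Set.mem_ofPred_eq] at hq
      rw [mem_closedBall_zero_iff, Prod.norm_def, max_le_iff, Real.norm_eq_abs]
      exact ⟨by nlinarith [sq_nonneg q.2], abs_le_one_iff_mul_self_le_one.2
        (by nlinarith [sq_nonneg ‖q.1‖])⟩
  have hcov : ∀ j, Continuous fun z : (Matrix (Fin n) (Fin n) ℂ × E n × Matrix (Fin n) (Fin n) ℝ)
      × (E n × ℝ) => complexCovector z.2.1 z.1.2.1 z.2.2 j := fun j => by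
    unfold complexCovector
    fun_prop
  have hA : ∀ j l, Continuous fun z : (Matrix (Fin n) (Fin n) ℂ × E n × Matrix (Fin n) (Fin n) ℝ)
      × (E n × ℝ) => z.1.1 j l := fun j l => by fun_prop
  have hH : ∀ j l, Continuous fun z : (Matrix (Fin n) (Fin n) ℂ × E n × Matrix (Fin n) (Fin n) ℝ)
      × (E n × ℝ) => z.1.2.2 j l := fun j l => by fun_prop
  obtain ⟨C, hC1, hC⟩ := (hJ.prod hSph).exists_one_le_mul_add_sq_mul
    (f := fun z => z.2.2 ^ 2 * formS z.1.1 z.1.2.1 z.1.2.2 z.2.1 z.2.2)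
    (h := fun z => ‖symbol z.1.1 (complexCovector z.2.1 z.1.2.1 z.2.2)‖ ^ 2)
    (by
      unfold formS
      refine (continuous_snd.comp continuous_snd).pow 2 |>.mul (continuous_re.comp ?_)
      refine continuous_finsetSum _ fun k _ => continuous_finsetSum _ fun j _ => ?_
      have hs : ∀ i, Continuous fun z : (Matrix (Fin n) (Fin n) ℂ × E n
          × Matrix (Fin n) (Fin n) ℝ) × (E n × ℝ) =>
          2 * ∑ l, z.1.1 i l * complexCovector z.2.1 z.1.2.1 z.2.2 l := fun i =>
        continuous_const.mul (continuous_finsetSum _ fun l _ => (hA i l).mul (hcov l))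
      exact ((continuous_ofReal.comp (hH k j)).mul (hs j)).mul (continuous_conj.comp (hs k)))
    (by
      unfold symbol
      refine (continuous_norm.comp ?_).pow 2
      exact continuous_finsetSum _ fun j _ => continuous_finsetSum _ fun l _ =>
        ((hA j l).mul (hcov j)).mul (hcov l))
    (fun _ _ => by positivity)
    (by
      rintro ⟨⟨A, g, H⟩, ξ, τ⟩ ⟨hz, hs⟩ h0
      simp only [Sph, Set.mem_ofPred_eq] at hs h0 hz ⊢
      have hp : symbol A (complexCovector ξ g τ) = 0 := by simpa using h0
      have hτ : τ ≠ 0 := by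
        rintro rfl
        have he := hell A g H hz ξ
        have : complexCovector ξ g 0 = fun j => (ξ j : ℂ) := by ext j; simp [complexCovector]
        rw [← this, hp, norm_zero] at he
        nlinarith
      have hS := hSP A g H hz ξ τ (fun h => hτ (Prod.ext_iff.1 h).2) hp
      rw [S_eq_formS (hsymm A g H hz)] at hS
      positivity)
  refine ⟨C, hC1, fun A g H hz ξ τ => ?_⟩
  rcases eq_or_ne (‖ξ‖ ^ 2 + τ ^ 2) 0 with h0 | h0
  · have hτ : τ = 0 := by nlinarith [sq_nonneg ‖ξ‖, sq_nonneg τ]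
    have hξ : ‖ξ‖ = 0 := by nlinarith [sq_nonneg ‖ξ‖, sq_nonneg τ]
    rw [hτ, hξ]
    simp only [ne_eq, OfNat.ofNat_ne_zero, not_false_eq_true, zero_pow, zero_mul, mul_zero,
      add_zero, zero_add]
    positivity
  · -- Scale to the unit sphere; both sides are homogeneous of degree four.
    have hpos : 0 < ‖ξ‖ ^ 2 + τ ^ 2 := lt_of_le_of_ne (by positivity) h0.symm
    obtain ⟨t, ht, htt⟩ : ∃ t : ℝ, 0 < t ∧ t ^ 2 = ‖ξ‖ ^ 2 + τ ^ 2 :=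
      ⟨√(‖ξ‖ ^ 2 + τ ^ 2), Real.sqrt_pos.2 hpos, Real.sq_sqrt hpos.le⟩
    have hmem : ((A, g, H), (t⁻¹ • ξ, t⁻¹ * τ)) ∈ J ×ˢ Sph := by
      refine ⟨hz, ?_⟩
      simp only [Sph, Set.mem_ofPred_eq, norm_smul, norm_inv, Real.norm_eq_abs, abs_of_pos ht]
      field_simp
      linarith
    have h1 := hC _ hmem
    simp only [formS_smul, complexCovector_smul, symbol_smul, norm_mul, norm_pow, norm_real,
      norm_inv, Real.norm_eq_abs, abs_of_pos ht] at h1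
    have h2 : t ^ 4 ≤ C * (τ ^ 2 * formS A g H ξ τ)
        + C ^ 2 * ‖symbol A (complexCovector ξ g τ)‖ ^ 2 := by
      have := mul_le_mul_of_nonneg_left h1 (show 0 ≤ t ^ 4 by positivity)
      rw [mul_one] at this
      refine this.trans (le_of_eq ?_)
      field_simp
    have h3 : t ^ 4 = (‖ξ‖ ^ 2 + τ ^ 2) ^ 2 := by rw [← htt]; ring
    nlinarith [mul_nonneg (sq_nonneg τ) (sq_nonneg ‖ξ‖)]

/-! ### Symbols and Plancherel's theorem -/

/-- A test function as a Schwartz function. -/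
noncomputable def IsTest.toSchwartz {f : E n → ℂ} (hf : IsTest f) : SchwartzMap (E n) ℂ :=
  hf.supp.toSchwartzMap hf.smooth

/-- The Fourier transform of `f` is `σ (2π ξ)` times that of `v`. The factor `2π` makes the symbol
of `D_j` equal to `ξ_j`. -/
def HasSymbol (v f : E n → ℂ) (σ : E n → ℂ) : Prop :=
  ∀ ξ, 𝓕 f ξ = σ ((2 * Real.pi) • ξ) * 𝓕 v ξ

theorem hasSymbol_self (v : E n → ℂ) : HasSymbol v v fun _ => 1 := fun ξ => by simp

theorem HasSymbol.D {v f : E n → ℂ} {σ : E n → ℂ} (hf : IsTest f) (h : HasSymbol v f σ)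
    (j : Fin n) : HasSymbol v (D j f) fun ξ => ξ j * σ ξ := by
  intro ξ
  have e : (hf.D j).toSchwartz = (-I) •
      LineDeriv.lineDerivOp (EuclideanSpace.single j (1 : ℝ)) hf.toSchwartz := by
    ext x
    rw [smul_apply, SchwartzMap.lineDerivOp_apply_eq_fderiv]
    rfl
  have e2 := congrArg (fun s : SchwartzMap (E n) ℂ => (𝓕 s) ξ) e
  simp only [FourierTransform.fourier_smul, SchwartzMap.fourier_lineDerivOp_eq] at e2
  have ht : (inner ℝ · (EuclideanSpace.single j (1 : ℝ)) : E n → ℝ).HasTemperateGrowth :=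
    ((innerSL ℝ).flip (EuclideanSpace.single j (1 : ℝ))).hasTemperateGrowth
  simp only [smul_apply, SchwartzMap.smulLeftCLM_apply_apply ht] at e2
  have h1 : 𝓕 (Carleman.D j f) ξ = (𝓕 (hf.D j).toSchwartz) ξ := rfl
  have h2 : (𝓕 hf.toSchwartz) ξ = 𝓕 f ξ := rfl
  rw [h1, e2, h2, h ξ]
  simp [EuclideanSpace.inner_single_right]
  ring_nf
  simp

theorem HasSymbol.add {v f f' : E n → ℂ} {σ σ' : E n → ℂ} (hf : IsTest f) (hf' : IsTest f')
    (h : HasSymbol v f σ) (h' : HasSymbol v f' σ') :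
    HasSymbol v (fun x => f x + f' x) fun ξ => σ ξ + σ' ξ := by
  intro ξ
  have e : (hf.add hf').toSchwartz = hf.toSchwartz + hf'.toSchwartz := rfl
  have e2 := congrArg (fun s : SchwartzMap (E n) ℂ => (𝓕 s) ξ) e
  simp only [FourierTransform.fourier_add, add_apply] at e2
  have h1 : 𝓕 (fun x => f x + f' x) ξ = (𝓕 (hf.add hf').toSchwartz) ξ := rfl
  have h2 : (𝓕 hf.toSchwartz) ξ = 𝓕 f ξ := rfl
  have h3 : (𝓕 hf'.toSchwartz) ξ = 𝓕 f' ξ := rfl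
  rw [h1, e2, h2, h3, h ξ, h' ξ]
  ring

theorem IsTest.const_mul {f : E n → ℂ} (hf : IsTest f) (c : ℂ) : IsTest (fun x => c * f x) :=
  hf.mul_left contDiff_const

theorem HasSymbol.const_mul {v f : E n → ℂ} {σ : E n → ℂ} (hf : IsTest f)
    (h : HasSymbol v f σ) (c : ℂ) : HasSymbol v (fun x => c * f x) fun ξ => c * σ ξ := by
  intro ξ
  have e : (hf.const_mul c).toSchwartz = c • hf.toSchwartz := rfl
  have e2 := congrArg (fun s : SchwartzMap (E n) ℂ => (𝓕 s) ξ) e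
  simp only [FourierTransform.fourier_smul, smul_apply] at e2
  have h1 : 𝓕 (fun x => c * f x) ξ = (𝓕 (hf.const_mul c).toSchwartz) ξ := rfl
  have h2 : (𝓕 hf.toSchwartz) ξ = 𝓕 f ξ := rfl
  rw [h1, e2, h2, h ξ, smul_eq_mul]
  ring

theorem HasSymbol.sum {ι : Type*} {s : Finset ι} {v : E n → ℂ} {f σ : ι → E n → ℂ}
    (hv : IsTest v) (hf : ∀ i, IsTest (f i)) (h : ∀ i, HasSymbol v (f i) (σ i)) :
    HasSymbol v (fun x => ∑ i ∈ s, f i x) fun ξ => ∑ i ∈ s, σ i ξ := by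
  classical
  induction s using Finset.induction_on with
  | empty =>
    simpa using (hasSymbol_self v).const_mul hv 0
  | insert i s hi ih =>
    simp only [Finset.sum_insert hi]
    exact HasSymbol.add (hf i) (IsTest.sum fun k _ => hf k) (h i) ih

theorem HasSymbol.X_linWeight {v f : E n → ℂ} {σ : E n → ℂ} (hf : IsTest f)
    (h : HasSymbol v f σ) (τ : ℝ) (g : E n) (j : Fin n) :
    HasSymbol v (X (linWeight τ g) j f) fun ξ => complexCovector ξ g τ j * σ ξ := by
  have h1 := HasSymbol.add (hf.D j) (hf.const_mul (I * (τ * g j : ℝ))) (h.D hf j)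
    (h.const_mul hf (I * (τ * g j : ℝ)))
  have e : X (linWeight τ g) j f = fun x => Carleman.D j f x + I * (τ * g j : ℝ) * f x := by
    ext x
    simp only [X, pd_linWeight]
  rw [e]
  convert h1 using 2 with ξ
  simp only [complexCovector]
  push_cast
  ring

theorem HasSymbol.X_neg_linWeight {v f : E n → ℂ} {σ : E n → ℂ} (hf : IsTest f)
    (h : HasSymbol v f σ) (τ : ℝ) (g : E n) (j : Fin n) :
    HasSymbol v (X (-linWeight τ g) j f) fun ξ => conj (complexCovector ξ g τ j) * σ ξ := by
  have e : -linWeight τ g = linWeight (-τ) g := by ext x; simp [linWeight]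
  rw [e]
  convert h.X_linWeight hf (-τ) g j using 2 with ξ
  simp [complexCovector]

/-- Plancherel's theorem in terms of symbols. -/
theorem HasSymbol.integral_mul_conj {v f h : E n → ℂ} {σ σ' : E n → ℂ} (hf : IsTest f)
    (hh : IsTest h) (h1 : HasSymbol v f σ) (h2 : HasSymbol v h σ') :
    Integrable (fun ξ => σ ((2 * Real.pi) • ξ) * conj (σ' ((2 * Real.pi) • ξ))
        * (‖𝓕 v ξ‖ ^ 2 : ℝ)) ∧
      ∫ x, f x * conj (h x) = ∫ ξ, σ ((2 * Real.pi) • ξ) * conj (σ' ((2 * Real.pi) • ξ))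
        * (‖𝓕 v ξ‖ ^ 2 : ℝ) := by
  have e : ∀ ξ, σ ((2 * Real.pi) • ξ) * conj (σ' ((2 * Real.pi) • ξ)) * (‖𝓕 v ξ‖ ^ 2 : ℝ)
      = (𝓕 hf.toSchwartz) ξ * conj ((𝓕 hh.toSchwartz) ξ) := fun ξ => by
    have h3 : (𝓕 hf.toSchwartz) ξ = 𝓕 f ξ := rfl
    have h4 : (𝓕 hh.toSchwartz) ξ = 𝓕 h ξ := rfl
    rw [h3, h4, h1 ξ, h2 ξ, ofReal_norm_sq, map_mul]
    ring
  simp only [e]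
  constructor
  · have hb : ∀ s : SchwartzMap (E n) ℂ, Integrable s := fun s => s.integrable
    refine (hb (𝓕 hf.toSchwartz)).mul_bdd
      (c := (SchwartzMap.seminorm ℝ 0 0 (𝓕 hh.toSchwartz))) ?_ ?_
    · exact (continuous_conj.comp (SchwartzMap.continuous _)).aestronglyMeasurable
    · refine ae_of_all _ fun ξ => ?_
      rw [RCLike.norm_conj]
      exact SchwartzMap.norm_le_seminorm ℝ _ _
  · have := SchwartzMap.integral_inner_fourier_fourier hh.toSchwartz hf.toSchwartz
    simp only [RCLike.inner_apply] at this
    rw [this]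
    rfl

/-! ### The estimate for frozen data -/

/-- The integral of the density `F` is the integral of the symbol `s (2π ξ)` against the spectral
measure `|𝓕 v|²`. -/
structure HasSpectralForm (v F s : E n → ℂ) : Prop where
  left : Integrable F
  right : Integrable (fun ξ => s ((2 * Real.pi) • ξ) * (‖𝓕 v ξ‖ ^ 2 : ℝ))
  eq : ∫ x, F x = ∫ ξ, s ((2 * Real.pi) • ξ) * (‖𝓕 v ξ‖ ^ 2 : ℝ)

namespace HasSpectralForm

variable {v F G s t : E n → ℂ}

theorem of_hasSymbol {f h σ σ' : E n → ℂ} (hf : IsTest f) (hh : IsTest h)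
    (h1 : HasSymbol v f σ) (h2 : HasSymbol v h σ') :
    HasSpectralForm v (fun x => f x * conj (h x)) (fun ξ => σ ξ * conj (σ' ξ)) :=
  ⟨(hf.mul_right hh.conjugate.smooth).integrable, (h1.integral_mul_conj hf hh h2).1,
    (h1.integral_mul_conj hf hh h2).2⟩

theorem add (hF : HasSpectralForm v F s) (hG : HasSpectralForm v G t) :
    HasSpectralForm v (fun x => F x + G x) (fun ξ => s ξ + t ξ) := by
  refine ⟨hF.left.add hG.left, ?_, ?_⟩
  · simp only [add_mul]; exact hF.right.add hG.right
  · simp only [add_mul]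
    rw [integral_add hF.left hG.left, integral_add hF.right hG.right, hF.eq, hG.eq]

theorem const_mul (hF : HasSpectralForm v F s) (c : ℂ) :
    HasSpectralForm v (fun x => c * F x) (fun ξ => c * s ξ) := by
  refine ⟨hF.left.const_mul c, ?_, ?_⟩
  · simp only [mul_assoc]; exact hF.right.const_mul c
  · simp only [mul_assoc]
    rw [integral_const_mul, integral_const_mul, hF.eq]

theorem sum {ι : Type*} {S : Finset ι} {F s : ι → E n → ℂ}
    (h : ∀ i, HasSpectralForm v (F i) (s i)) :
    HasSpectralForm v (fun x => ∑ i ∈ S, F i x) (fun ξ => ∑ i ∈ S, s i ξ) := by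
  refine ⟨integrable_finsetSum _ fun i _ => (h i).left, ?_, ?_⟩
  · simp only [Finset.sum_mul]
    exact integrable_finsetSum _ fun i _ => (h i).right
  · simp only [Finset.sum_mul]
    rw [integral_finsetSum _ fun i _ => (h i).left, integral_finsetSum _ fun i _ => (h i).right]
    exact Finset.sum_congr rfl fun i _ => (h i).eq

theorem re_integral_nonneg (h : HasSpectralForm v F s) (hs : ∀ ξ, 0 ≤ (s ξ).re) :
    0 ≤ (∫ x, F x).re := by
  rw [h.eq]
  have := integral_re h.right
  simp only [RCLike.re_eq_complex_re] at this
  rw [← this]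
  refine integral_nonneg fun ξ => ?_
  rw [re_mul_ofReal]
  exact mul_nonneg (hs _) (by positivity)

end HasSpectralForm

/-- The square of the `τ`-weighted second order jet of `v`; each `τ` counts as a derivative. -/
noncomputable def jetSq (τ : ℝ) (v : E n → ℂ) (x : E n) : ℝ :=
  (∑ p : Fin n × Fin n, ‖D p.1 (D p.2 v) x‖ ^ 2) + τ ^ 2 * (∑ j, ‖D j v x‖ ^ 2)
    + τ ^ 4 * ‖v x‖ ^ 2

theorem jetSq_nonneg (τ : ℝ) (v : E n → ℂ) (x : E n) : 0 ≤ jetSq τ v x := by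
  unfold jetSq; positivity

/-- The integral of `jetSq` is the left-hand side of the symbol inequality, by Plancherel. -/
theorem hasSpectralForm_jetSq {v : E n → ℂ} (hv : IsTest v) (τ : ℝ) :
    HasSpectralForm v (fun x => (jetSq τ v x : ℂ))
      (fun ξ => ((‖ξ‖ ^ 4 + τ ^ 2 * ‖ξ‖ ^ 2 + τ ^ 4 : ℝ) : ℂ)) := by
  have h0 := hasSymbol_self v
  have h1 : ∀ j, HasSymbol v (D j v) _ := fun j => h0.D hv j
  have h2 : ∀ p : Fin n × Fin n, HasSymbol v (D p.1 (D p.2 v)) _ := fun p =>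
    (h1 p.2).D (hv.D p.2) p.1
  have h := ((HasSpectralForm.sum (S := Finset.univ) fun p : Fin n × Fin n =>
      HasSpectralForm.of_hasSymbol ((hv.D p.2).D p.1) ((hv.D p.2).D p.1) (h2 p) (h2 p)).add
    ((HasSpectralForm.sum (S := Finset.univ) fun j =>
      HasSpectralForm.of_hasSymbol (hv.D j) (hv.D j) (h1 j) (h1 j)).const_mul
        ((τ ^ 2 : ℝ) : ℂ))).add
    ((HasSpectralForm.of_hasSymbol hv hv h0 h0).const_mul ((τ ^ 4 : ℝ) : ℂ))
  convert h using 2 with x ξ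
  · simp only [jetSq, ← ofReal_norm_sq]
    push_cast
    ring
  · have e : ∀ j, ((ξ j : ℂ) * 1) * conj ((ξ j : ℂ) * 1) = ((ξ j ^ 2 : ℝ) : ℂ) := fun j => by
      rw [mul_one, conj_ofReal]; push_cast; ring
    have e2 : ∀ p : Fin n × Fin n, ((ξ p.1 : ℂ) * ((ξ p.2 : ℂ) * 1))
        * conj ((ξ p.1 : ℂ) * ((ξ p.2 : ℂ) * 1)) = ((ξ p.1 ^ 2 * ξ p.2 ^ 2 : ℝ) : ℂ) := fun p => by
      rw [mul_one, map_mul, conj_ofReal, conj_ofReal]; push_cast; ring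
    have hn : ‖ξ‖ ^ 2 = ∑ j, ξ j ^ 2 := by
      rw [EuclideanSpace.norm_sq_eq]; simp
    have hn4 : ‖ξ‖ ^ 4 = ∑ p : Fin n × Fin n, ξ p.1 ^ 2 * ξ p.2 ^ 2 := by
      simp only [Fintype.sum_prod_type, ← Finset.sum_mul_sum, ← hn]; ring
    simp only [e, e2, ← ofReal_sum, ← hn, ← hn4]
    simp

section

variable {A : Matrix (Fin n) (Fin n) ℂ} {g : E n} {H : Matrix (Fin n) (Fin n) ℝ} {v : E n → ℂ}

theorem hasSymbol_conjOp (A : Matrix (Fin n) (Fin n) ℂ) (g : E n) (hv : IsTest v) (τ : ℝ) :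
    HasSymbol v (conjOp (linWeight τ g) (fun p _ => A p.1 p.2) v)
      (fun ξ => symbol A (complexCovector ξ g τ)) := by
  have hχ := contDiff_linWeight τ g
  have h := HasSymbol.sum (s := Finset.univ) hv
    (fun p : Fin n × Fin n => ((hv.X hχ p.2).X hχ p.1).const_mul (A p.1 p.2))
    (fun p => (((hasSymbol_self v).X_linWeight hv τ g p.2).X_linWeight
      (hv.X hχ p.2) τ g p.1).const_mul ((hv.X hχ p.2).X hχ p.1) (A p.1 p.2))
  convert h using 2 with ξ
  · rfl
  · simp only [symbol, Fintype.sum_prod_type, mul_one, mul_assoc]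

theorem isTest_conjOp {ψ : E n → ℝ} {a : Fin n × Fin n → E n → ℂ} (hψ : ContDiff ℝ ∞ ψ)
    (ha : ∀ p, ContDiff ℝ ∞ (a p)) (hv : IsTest v) : IsTest (conjOp ψ a v) :=
  IsTest.sum fun p _ => ((hv.X hψ p.2).X hψ p.1).mul_left (ha p)

/-- The frozen commutator form has symbol `2τ S`. -/
theorem hasSpectralForm_frozenDensity (hA : ∀ j l, A j l = A l j) (g : E n)
    (H : Matrix (Fin n) (Fin n) ℝ) (hv : IsTest v) (τ : ℝ) :
    ∃ s : E n → ℂ, (∀ ξ, (s ξ).re = 2 * τ * formS A g H ξ τ) ∧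
      HasSpectralForm v (fun x => ∑ p : Fin n × Fin n, ∑ q : Fin n × Fin n,
        frozenDensity τ H (linWeight τ g) (A p.1 p.2 * conj (A q.1 q.2)) v p.1 p.2 q.1 q.2 x)
        s := by
  set χ := linWeight τ g with hχd
  have hχ : ContDiff ℝ ∞ χ := contDiff_linWeight τ g
  have hn := contDiff_neg hχ
  have h0 := hasSymbol_self v
  have P := fun j => h0.X_linWeight hv τ g j
  have M := fun j => h0.X_neg_linWeight hv τ g j
  have MP := fun j k => (P k).X_neg_linWeight (hv.X hχ k) τ g j
  have PM := fun j k => (M k).X_linWeight (hv.X hn k) τ g j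
  -- The four terms of the frozen density are one and the same form, up to swapping the indices in
  -- the pairs `p` and `q`; the symmetry of `A` makes the sums over all pairs equal.
  let T : Fin n × Fin n → Fin n × Fin n → E n → ℂ := fun p q ξ =>
    A p.1 p.2 * conj (A q.1 q.2) * H q.1 p.1 * complexCovector ξ g τ p.2
      * conj (complexCovector ξ g τ q.2)
  have key : ∀ p q : Fin n × Fin n, HasSpectralForm v
      (frozenDensity τ H χ (A p.1 p.2 * conj (A q.1 q.2)) v p.1 p.2 q.1 q.2)
      (fun ξ => 2 * τ * (T p q ξ + T p.swap q ξ + T p q.swap ξ + T p.swap q.swap ξ)) := by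
    intro p q
    have h := ((((HasSpectralForm.of_hasSymbol (hv.X hχ p.2) (hv.X hχ q.2) (P p.2)
        (P q.2)).const_mul (2 * (A p.1 p.2 * conj (A q.1 q.2)) * (τ * H q.1 p.1 : ℝ))).add
      ((HasSpectralForm.of_hasSymbol hv ((hv.X hχ q.2).X hn p.1) h0
        (MP p.1 q.2)).const_mul (2 * (A p.1 p.2 * conj (A q.1 q.2)) * (τ * H q.1 p.2 : ℝ)))).add
      ((HasSpectralForm.of_hasSymbol ((hv.X hn q.1).X hχ p.2) hv (PM p.2 q.1)
        h0).const_mul (2 * (A p.1 p.2 * conj (A q.1 q.2)) * (τ * H q.2 p.1 : ℝ)))).add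
      ((HasSpectralForm.of_hasSymbol (hv.X hn q.1) (hv.X hn p.1) (M q.1)
        (M p.1)).const_mul (2 * (A p.1 p.2 * conj (A q.1 q.2)) * (τ * H q.2 p.2 : ℝ)))
    convert h using 2 with x ξ
    · simp only [frozenDensity]
      ring
    · simp only [T, Prod.fst_swap, Prod.snd_swap, hA p.2 p.1, hA q.2 q.1, map_mul, conj_conj,
        map_one, mul_one, one_mul]
      push_cast
      ring
  refine ⟨_, fun ξ => ?_, HasSpectralForm.sum fun p => HasSpectralForm.sum fun q => key p q⟩
  have hswap : ∀ F : Fin n × Fin n → ℂ, ∑ p : Fin n × Fin n, F p.swap = ∑ p, F p := fun F =>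
    Equiv.sum_comp (Equiv.prodComm _ _) F
  have e2 : ∑ p : Fin n × Fin n, ∑ q, T p.swap q ξ = ∑ p, ∑ q, T p q ξ :=
    hswap fun p => ∑ q, T p q ξ
  have e3 : ∑ p, ∑ q : Fin n × Fin n, T p q.swap ξ = ∑ p, ∑ q, T p q ξ :=
    Finset.sum_congr rfl fun p _ => hswap fun q => T p q ξ
  have e4 : ∑ p : Fin n × Fin n, ∑ q : Fin n × Fin n, T p.swap q.swap ξ = ∑ p, ∑ q, T p q ξ := by
    exact (hswap fun p => ∑ q : Fin n × Fin n, T p q.swap ξ).trans e3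
  have hform : formS A g H ξ τ = (4 * ∑ p, ∑ q, T p q ξ).re := by
    have e5 : ∀ j k, (H k j : ℂ) * (2 * ∑ l, A j l * complexCovector ξ g τ l)
        * conj (2 * ∑ m, A k m * complexCovector ξ g τ m)
        = ∑ l, ∑ m, 4 * T (j, l) (k, m) ξ := by
      intro j k
      rw [map_mul, map_sum, map_ofNat, show ∀ a b c : ℂ, a * (2 * b) * (2 * c) = 4 * a * (b * c) by
        intros; ring, Finset.sum_mul_sum, Finset.mul_sum]
      refine Finset.sum_congr rfl fun l _ => ?_
      rw [Finset.mul_sum]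
      refine Finset.sum_congr rfl fun m _ => ?_
      simp only [T, map_mul]
      ring
    simp only [formS, e5]
    simp only [Fintype.sum_prod_type, Finset.mul_sum]
    rw [Finset.sum_comm]
    refine congrArg Complex.re (Finset.sum_congr rfl fun j _ => ?_)
    rw [Finset.sum_comm]
  simp only [← Finset.mul_sum, Finset.sum_add_distrib, e2, e3, e4]
  rw [hform, show (2 : ℂ) * τ = ((2 * τ : ℝ) : ℂ) by push_cast; ring, re_ofReal_mul]
  congr 2
  ring

/-- The estimate for constant coefficients and an affine weight. -/
theorem integral_jetSq_le_frozen {C : ℝ} (hA : ∀ j l, A j l = A l j) (hv : IsTest v) (τ : ℝ)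
    (hC : ∀ ξ : E n, ‖ξ‖ ^ 4 + τ ^ 2 * ‖ξ‖ ^ 2 + τ ^ 4
        ≤ C * (τ ^ 2 * formS A g H ξ τ) + C ^ 2 * ‖symbol A (complexCovector ξ g τ)‖ ^ 2) :
    ∫ x, jetSq τ v x ≤ C * (τ / 2) * (∫ x, ∑ p : Fin n × Fin n, ∑ q : Fin n × Fin n,
        frozenDensity τ H (linWeight τ g) (A p.1 p.2 * conj (A q.1 q.2)) v p.1 p.2 q.1 q.2 x).re
      + C ^ 2 * ∫ x, ‖conjOp (linWeight τ g) (fun p _ => A p.1 p.2) v x‖ ^ 2 := by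
  obtain ⟨s, hs, hF⟩ := hasSpectralForm_frozenDensity hA g H hv τ
  have hχ := contDiff_linWeight τ g
  have hL := hasSymbol_conjOp A g hv τ
  have hLt : IsTest (conjOp (linWeight τ g) (fun p _ => A p.1 p.2) v) :=
    isTest_conjOp hχ (fun _ => contDiff_const) hv
  have hLL := HasSpectralForm.of_hasSymbol hLt hLt hL hL
  have hJ := hasSpectralForm_jetSq hv τ
  have h := ((hF.const_mul ((C * (τ / 2) : ℝ) : ℂ)).add (hLL.const_mul ((C ^ 2 : ℝ) : ℂ))).add
    (hJ.const_mul (-1))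
  have h0 := h.re_integral_nonneg fun ξ => by
    rw [add_re, add_re, re_ofReal_mul, re_ofReal_mul, hs, ← ofReal_norm_sq, ofReal_re,
      neg_one_mul, neg_re, ofReal_re]
    nlinarith [hC ξ]
  have i1 := hF.left.const_mul ((C * (τ / 2) : ℝ) : ℂ)
  have i2 := hLL.left.const_mul ((C ^ 2 : ℝ) : ℂ)
  have i3 := hJ.left.const_mul (-1)
  have e1 := integral_add (i1.add i2) i3
  simp only [Pi.add_apply] at e1
  rw [e1, integral_add i1 i2, integral_const_mul, integral_const_mul, integral_const_mul, add_re,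
    add_re, re_ofReal_mul, re_ofReal_mul] at h0
  simp only [← ofReal_norm_sq] at h0
  rw [integral_complex_ofReal, integral_complex_ofReal, ofReal_re, neg_one_mul, neg_re,
    ofReal_re] at h0
  linarith

end

/-! ### Data close to constant data -/

theorem tsupport_D_subset (j : Fin n) (f : E n → ℂ) : tsupport (D j f) ⊆ tsupport f := by
  unfold D
  refine (tsupport_mul_subset_right).trans ?_
  exact (tsupport_fderiv_apply_subset ℝ _)

theorem tsupport_X_subset (ψ : E n → ℝ) (j : Fin n) (f : E n → ℂ) :
    tsupport (X ψ j f) ⊆ tsupport f := by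
  unfold X
  refine (tsupport_add _ _).trans (Set.union_subset (tsupport_D_subset j f) ?_)
  exact tsupport_mul_subset_right

theorem D_D_eq_zero_of_notMem_tsupport {u : E n → ℂ} {x : E n} (hx : x ∉ tsupport u)
    (j l : Fin n) : D j (D l u) x = 0 :=
  image_eq_zero_of_notMem_tsupport fun h =>
    hx (tsupport_D_subset l u (tsupport_D_subset j (D l u) h))

theorem D_eq_zero_of_notMem_tsupport {u : E n → ℂ} {x : E n} (hx : x ∉ tsupport u)
    (j : Fin n) : D j u x = 0 :=
  image_eq_zero_of_notMem_tsupport fun h => hx (tsupport_D_subset j u h)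

theorem jetSq_eq_zero_of_notMem_tsupport {u : E n → ℂ} {x : E n} (hx : x ∉ tsupport u) (τ : ℝ) :
    jetSq τ u x = 0 := by
  simp [jetSq, D_D_eq_zero_of_notMem_tsupport hx, D_eq_zero_of_notMem_tsupport hx,
    image_eq_zero_of_notMem_tsupport hx]

theorem jetBound_sqrt_jetSq {τ : ℝ} (hτ : 0 < τ) (v : E n → ℂ) (x : E n) :
    JetBound √(jetSq τ v x) τ v x := by
  have h0 : 0 ≤ ∑ p : Fin n × Fin n, ‖D p.1 (D p.2 v) x‖ ^ 2 := by positivity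
  have h1 : 0 ≤ τ ^ 2 * ∑ j, ‖D j v x‖ ^ 2 := by positivity
  have h2 : 0 ≤ τ ^ 4 * ‖v x‖ ^ 2 := by positivity
  refine ⟨?_, fun j => ?_, fun j l => ?_⟩
  · rw [le_div_iff₀ (by positivity)]
    refine Real.le_sqrt_of_sq_le ?_
    rw [mul_pow, mul_comm, ← pow_mul]
    exact le_add_of_nonneg_left (add_nonneg h0 h1)
  · rw [le_div_iff₀ (by positivity)]
    refine Real.le_sqrt_of_sq_le ?_
    have h3 : ‖D j v x‖ ^ 2 ≤ ∑ j, ‖D j v x‖ ^ 2 :=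
      Finset.single_le_sum (f := fun j => ‖D j v x‖ ^ 2) (fun _ _ => by positivity)
        (Finset.mem_univ j)
    have h4 := mul_le_mul_of_nonneg_left h3 (sq_nonneg τ)
    rw [mul_pow, mul_comm]
    exact h4.trans ((le_add_of_nonneg_left h0).trans (le_add_of_nonneg_right h2))
  · refine Real.le_sqrt_of_sq_le ?_
    let f : Fin n × Fin n → ℝ := fun p => ‖D p.1 (D p.2 v) x‖ ^ 2
    have h3 : f (j, l) ≤ ∑ p, f p :=
      Finset.single_le_sum (fun p _ => sq_nonneg ‖D p.1 (D p.2 v) x‖) (Finset.mem_univ _)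
    exact h3.trans ((le_add_of_nonneg_right h1).trans (le_add_of_nonneg_right h2))

theorem integrable_jetSq {v : E n → ℂ} (hv : IsTest v) (τ : ℝ) : Integrable (jetSq τ v) := by
  unfold jetSq
  exact ((integrable_finsetSum _ fun p _ => ((hv.D _).D _).integrable_norm_sq).add
    ((integrable_finsetSum _ fun j _ => (hv.D j).integrable_norm_sq).const_mul _)).add
    (hv.integrable_norm_sq.const_mul _)

/-- The coefficients `a` and the weight `φ` are `η`-close, up to first derivatives of `a` and
second derivatives of `φ`, to the constant data `(A, g, H)` at the point `x`. -/
structure DataNear (η : ℝ) (A : Matrix (Fin n) (Fin n) ℂ) (g : E n)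
    (H : Matrix (Fin n) (Fin n) ℝ) (a : Fin n × Fin n → E n → ℂ) (φ : E n → ℝ) (x : E n) :
    Prop where
  coeff : ∀ p, ‖a p x - A p.1 p.2‖ ≤ η
  coeff_deriv : ∀ p i, ‖D i (a p) x‖ ≤ η
  grad : ∀ j, |pd j φ x - g j| ≤ η
  hess : ∀ j k, |pd j (pd k φ) x - H j k| ≤ η

/-- All entries of the triple `(A, g, H)` have absolute value at most `B`. -/
structure DataBound (B : ℝ) (A : Matrix (Fin n) (Fin n) ℂ) (g : E n)
    (H : Matrix (Fin n) (Fin n) ℝ) : Prop where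
  coeff : ∀ j l, ‖A j l‖ ≤ B
  grad : ∀ j, |g j| ≤ B
  hess : ∀ j k, |H j k| ≤ B

theorem pd_const_mul {φ : E n → ℝ} (hφ : Differentiable ℝ φ) (τ : ℝ) (j : Fin n) :
    pd j (fun x => τ * φ x) = fun x => τ * pd j φ x := by
  ext x
  simp [pd, fderiv_const_mul (hφ x)]

section

variable {η K τ : ℝ} {A : Matrix (Fin n) (Fin n) ℂ} {g : E n} {H : Matrix (Fin n) (Fin n) ℝ}
  {a : Fin n × Fin n → E n → ℂ} {φ : E n → ℝ} {v : E n → ℂ} {x : E n}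

theorem near_of_norm_sub_le {B : ℝ} {z w : ℂ} (hη : 0 ≤ η) (hη1 : η ≤ 1) (hB : 0 ≤ B)
    (hw : ‖w‖ ≤ B) (h : ‖z - w‖ ≤ η) : Near η (B + 1) z w := by
  refine ⟨?_, by linarith, h.trans (by nlinarith)⟩
  calc ‖z‖ = ‖(z - w) + w‖ := by ring_nf
    _ ≤ ‖z - w‖ + ‖w‖ := norm_add_le _ _
    _ ≤ B + 1 := by linarith

theorem near_mul_of_abs_sub_le {B y w : ℝ} (hη : 0 ≤ η) (hη1 : η ≤ 1) (hB : 0 ≤ B) (hτ : 0 < τ)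
    (hw : |w| ≤ B) (h : |y - w| ≤ η) :
    Near η ((B + 1) * τ) ((τ * y : ℝ) : ℂ) ((τ * w : ℝ) : ℂ) := by
  obtain ⟨h1, h2, h3⟩ := near_of_norm_sub_le (z := (y : ℂ)) (w := (w : ℂ)) hη hη1 hB
    (by simpa using hw) (by rw [← ofReal_sub, norm_real]; exact h)
  have hs : ∀ r : ℝ, ‖((τ * r : ℝ) : ℂ)‖ = τ * ‖(r : ℂ)‖ := fun r => by
    rw [ofReal_mul, norm_mul, norm_real, Real.norm_of_nonneg hτ.le]
  refine ⟨?_, ?_, ?_⟩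
  · rw [hs, mul_comm]; gcongr
  · rw [hs, mul_comm]; gcongr
  · rw [← ofReal_sub, ← mul_sub, hs, ofReal_sub]
    nlinarith

theorem DataNear.weightNear (hφ : ContDiff ℝ ∞ φ) (hη : 0 ≤ η) (hη1 : η ≤ 1) (hK : 0 ≤ K)
    (hτ : 0 < τ) (hB : DataBound K A g H) (h : DataNear η A g H a φ x) :
    WeightNear η (K + 1) τ (fun x => τ * φ x) (linWeight τ g) x := by
  have hd : Differentiable ℝ φ := hφ.differentiable (by simp)
  have hd2 : ∀ k, Differentiable ℝ (pd k φ) := fun k =>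
    (contDiff_pd hφ k).differentiable (by simp)
  refine ⟨fun j => ?_, fun j k => ?_, fun j k => pd_pd_linWeight τ g j k x⟩
  · rw [pd_const_mul hd, pd_linWeight]
    exact near_mul_of_abs_sub_le hη hη1 hK hτ (hB.grad j) (h.grad j)
  · rw [pd_const_mul hd, pd_const_mul (hd2 k)]
    have := (near_mul_of_abs_sub_le hη hη1 hK hτ (hB.hess j k) (h.hess j k)).1
    rwa [norm_real] at this

theorem DataNear.near_commDensity (hφ : ContDiff ℝ ∞ φ) (ha : ∀ p, ContDiff ℝ ∞ (a p))
    (hv : IsTest v) (hη : 0 ≤ η) (hη1 : η ≤ 1) (hK : 0 ≤ K)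
    (hτ : 0 < τ) (hτη : 1 / τ ≤ η) (hB : DataBound K A g H) (h : DataNear η A g H a φ x)
    (p q : Fin n × Fin n) :
    Near η (10000 * (K + 1) ^ 5 * (jetSq τ v x / τ))
      (commDensity (fun x => τ * φ x) (fun y => a p y * conj (a q y)) v p.1 p.2 q.1 q.2 x)
      (frozenDensity τ H (linWeight τ g) (A p.1 p.2 * conj (A q.1 q.2)) v p.1 p.2 q.1 q.2 x) := by
  have hd : Differentiable ℝ φ := hφ.differentiable (by simp)
  have hd2 : ∀ k, Differentiable ℝ (pd k φ) := fun k =>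
    (contDiff_pd hφ k).differentiable (by simp)
  have hc : ∀ p, Near η (K + 1) (a p x) (A p.1 p.2) := fun p =>
    near_of_norm_sub_le hη hη1 hK (hB.coeff _ _) (h.coeff p)
  have had : ∀ p, Differentiable ℝ (a p) := fun p => (ha p).differentiable (by simp)
  have hcd : Differentiable ℝ fun y => conj (a q y) :=
    (contDiff_conj_comp (ha q)).differentiable (by simp)
  rw [← Real.sq_sqrt (jetSq_nonneg τ v x)]
  refine Carleman.near_commDensity hη hη1 (by linarith) (Real.sqrt_nonneg _) hτ hτη
    (contDiff_const.mul hφ) (contDiff_linWeight τ g) hv (jetBound_sqrt_jetSq hτ v x)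
    (h.weightNear hφ hη hη1 hK hτ hB) (fun j k => ?_) ?_ (fun i => ?_) _ _ _ _
  · rw [pd_const_mul hd, pd_const_mul (hd2 k)]
    exact near_mul_of_abs_sub_le hη hη1 hK hτ (hB.hess j k) (h.hess j k)
  · convert (hc p).mul (hc q).conjugate using 1
    ring
  · rw [D_mul (had p) hcd, D_conj (had q)]
    refine (norm_add_le _ _).trans ?_
    rw [norm_mul, norm_mul, norm_neg, RCLike.norm_conj, RCLike.norm_conj]
    have h1 := mul_le_mul (h.coeff_deriv p i) (hc q).1 (norm_nonneg _) hη
    have h2 := mul_le_mul (hc p).1 (h.coeff_deriv q i) (norm_nonneg _) (by linarith)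
    have h3 : η * (K + 1) ≤ η * (K + 1) ^ 2 := by
      gcongr; nlinarith
    linarith

theorem DataNear.near_conjOp (hφ : ContDiff ℝ ∞ φ)
    (hv : IsTest v) (hη : 0 ≤ η) (hη1 : η ≤ 1) (hK : 0 ≤ K)
    (hτ : 0 < τ) (hτη : 1 / τ ≤ η) (hB : DataBound K A g H) (h : DataNear η A g H a φ x) :
    Near η (n ^ 2 * (40 * (K + 1) ^ 3) * √(jetSq τ v x)) (conjOp (fun x => τ * φ x) a v x)
      (conjOp (linWeight τ g) (fun p _ => A p.1 p.2) v x) := by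
  have hw := h.weightNear hφ hη hη1 hK hτ hB
  have hs := Near.sum (s := Finset.univ) fun (p : Fin n × Fin n) _ =>
    (near_of_norm_sub_le hη hη1 hK (hB.coeff _ _) (h.coeff p)).mul
    (near_X_X hη hη1 (show 1 ≤ K + 1 by linarith) (Real.sqrt_nonneg (jetSq τ v x)) hτ hτη
      (contDiff_const.mul hφ) (contDiff_linWeight τ g) hv (jetBound_sqrt_jetSq hτ v x) hw hw
      p.1 p.2)
  unfold conjOp
  convert hs using 1
  simp
  ring

end

/-! ### The Carleman estimate for smooth data -/

theorem X_eq_zero {ψ : E n → ℝ} {j : Fin n} {f : E n → ℂ} {x : E n} (hx : x ∉ tsupport f) :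
    X ψ j f x = 0 :=
  image_eq_zero_of_notMem_tsupport fun h => hx (tsupport_X_subset ψ j f h)

theorem X_X_eq_zero {ψ χ : E n → ℝ} {j k : Fin n} {f : E n → ℂ} {x : E n} (hx : x ∉ tsupport f) :
    X ψ j (X χ k f) x = 0 :=
  X_eq_zero fun h => hx (tsupport_X_subset χ k f h)

/-- Absorption of the error terms of size `η` into the left-hand side `I`. Here `R` and `S` stand
for the frozen commutator form and the frozen operator, `L` for the given operator. -/
theorem le_of_perturbed_le {C N M η τ I L R S : ℝ} (hC : 1 ≤ C) (hη : 0 ≤ η) (hη1 : η ≤ 1)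
    (hτ : 1 ≤ τ) (hI : 0 ≤ I) (hL : 0 ≤ L) (hηB : η * (C * N / 2 + 2 * C ^ 2 * M ^ 2) ≤ 1 / 2)
    (hR : R ≤ L + η * N / τ * I) (hS : S ≤ 2 * L + 2 * (η * M) ^ 2 * I)
    (h : I ≤ C * (τ / 2) * R + C ^ 2 * S) : I ≤ (C + 4 * C ^ 2) * τ * L := by
  have hτ0 : 0 < τ := by linarith
  have h4 : C * (τ / 2) * R ≤ C * (τ / 2) * (L + η * N / τ * I) := by gcongr
  have h5 := mul_le_mul_of_nonneg_left hS (sq_nonneg C)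
  have h6 : C * (τ / 2) * (L + η * N / τ * I) = C * τ / 2 * L + η * (C * N / 2) * I := by
    field_simp
  have h8 : η ^ 2 * (2 * C ^ 2 * M ^ 2 * I) ≤ η * (2 * C ^ 2 * M ^ 2 * I) := by
    gcongr
    exact pow_le_of_le_one hη hη1 two_ne_zero
  have h7 : C ^ 2 * (2 * L + 2 * (η * M) ^ 2 * I)
      = 2 * C ^ 2 * L + η ^ 2 * (2 * C ^ 2 * M ^ 2 * I) := by ring
  have h10 : η * (C * N / 2 + 2 * C ^ 2 * M ^ 2) * I ≤ 1 / 2 * I := by gcongr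
  have h11 : η * (C * N / 2 + 2 * C ^ 2 * M ^ 2) * I
      = η * (C * N / 2) * I + η * (2 * C ^ 2 * M ^ 2 * I) := by ring
  have h12 : 4 * C ^ 2 * L ≤ 4 * C ^ 2 * L * τ := le_mul_of_one_le_right (by positivity) hτ
  have h13 : (C + 4 * C ^ 2) * τ * L = C * τ * L + 4 * C ^ 2 * L * τ := by ring
  rw [h13]
  have h14 : C * τ / 2 * L = C * τ * L / 2 := by ring
  generalize C * τ * L = x1 at *
  linarith

/-- The weighted second order estimate for the conjugated operator. The differences between the
variable and the frozen forms are absorbed, because they carry the small factor `η`. -/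
theorem exists_integral_jetSq_le (n : ℕ) {C K : ℝ} (hC : 1 ≤ C) (hK : 0 ≤ K) :
    ∃ η C' : ℝ, 0 < η ∧ η ≤ 1 ∧ 0 ≤ C' ∧
      ∀ (A : Matrix (Fin n) (Fin n) ℂ) (g : E n) (H : Matrix (Fin n) (Fin n) ℝ),
        (∀ j l, A j l = A l j) → DataBound K A g H →
        (∀ (ξ : E n) (τ : ℝ), ‖ξ‖ ^ 4 + τ ^ 2 * ‖ξ‖ ^ 2 + τ ^ 4
          ≤ C * (τ ^ 2 * formS A g H ξ τ) + C ^ 2 * ‖symbol A (complexCovector ξ g τ)‖ ^ 2) →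
        ∀ (a : Fin n × Fin n → E n → ℂ) (φ : E n → ℝ) (v : E n → ℂ),
          (∀ p, ContDiff ℝ ∞ (a p)) → ContDiff ℝ ∞ φ → IsTest v →
          (∀ x ∈ tsupport v, DataNear η A g H a φ x) →
          ∀ τ : ℝ, 0 < τ → 1 / τ ≤ η →
            ∫ x, jetSq τ v x ≤ C' * τ * ∫ x, ‖conjOp (fun x => τ * φ x) a v x‖ ^ 2 := by
  set c : ℝ := (Fintype.card (Fin n × Fin n) : ℝ) with hc
  set N : ℝ := c * (c * (10000 * (K + 1) ^ 5)) with hN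
  set M : ℝ := n ^ 2 * (40 * (K + 1) ^ 3) with hM
  have hN0 : 0 ≤ N := by positivity
  have hM0 : 0 ≤ M := by positivity
  set B : ℝ := C * N / 2 + 2 * C ^ 2 * M ^ 2 with hB
  have hB0 : 0 ≤ B := by positivity
  -- `B` collects the constants in the errors, and `η B ≤ 1 / 2` allows their absorption.
  refine ⟨1 / (2 * B + 1), C + 4 * C ^ 2, by positivity, ?_, by positivity, ?_⟩
  · rw [div_le_one (by positivity)]; linarith
  set η : ℝ := 1 / (2 * B + 1) with hη
  have hη0 : 0 < η := by positivity
  have hη1 : η ≤ 1 := by rw [hη, div_le_one (by positivity)]; linarith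
  have hηB : η * B ≤ 1 / 2 := by
    rw [hη, div_mul_eq_mul_div, one_mul, div_le_iff₀ (by positivity)]; linarith
  intro A g H hA hD hest a φ v ha hφ hv hnear τ hτ hτη
  have hτ1 : 1 ≤ τ := by
    have := hτη.trans hη1
    rwa [div_le_one hτ] at this
  set ψ : E n → ℝ := fun x => τ * φ x with hψd
  have hψ : ContDiff ℝ ∞ ψ := contDiff_const.mul hφ
  have hW0 : ∀ x, 0 ≤ jetSq τ v x := jetSq_nonneg τ v
  have hWi := integrable_jetSq hv τ
  set comm : E n → ℂ := fun x => ∑ p : Fin n × Fin n, ∑ q : Fin n × Fin n,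
    commDensity ψ (fun y => a p y * conj (a q y)) v p.1 p.2 q.1 q.2 x with hcomm
  set froz : E n → ℂ := fun x => ∑ p : Fin n × Fin n, ∑ q : Fin n × Fin n,
    frozenDensity τ H (linWeight τ g) (A p.1 p.2 * conj (A q.1 q.2)) v p.1 p.2 q.1 q.2 x
    with hfroz
  have hcommi : Integrable comm := integrable_finsetSum _ fun p _ => integrable_finsetSum _
    fun q _ => (isTest_commDensity hψ ((ha p).mul (contDiff_conj_comp (ha q))) hv
      _ _ _ _).integrable
  have hfrozi : Integrable froz := (hasSpectralForm_frozenDensity hA g H hv τ).choose_spec.2.left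
  have hpt : ∀ x, ‖froz x - comm x‖ ≤ η * N / τ * jetSq τ v x := by
    intro x
    by_cases hx : x ∈ tsupport v
    · have h := Near.sum (s := Finset.univ) fun (p : Fin n × Fin n) _ =>
        Near.sum (s := Finset.univ) fun (q : Fin n × Fin n) _ =>
          (hnear x hx).near_commDensity hφ ha hv hη0.le hη1 hK hτ hτη hD p q
      rw [norm_sub_rev]
      refine h.2.2.trans (le_of_eq ?_)
      rw [Finset.card_univ, ← hc, hN]
      ring
    · have h1 : comm x = 0 := Finset.sum_eq_zero fun p _ => Finset.sum_eq_zero fun q _ => by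
        simp [commDensity, X_eq_zero hx, X_X_eq_zero hx]
      have h2 : froz x = 0 := Finset.sum_eq_zero fun p _ => Finset.sum_eq_zero fun q _ => by
        simp [frozenDensity, X_eq_zero hx, X_X_eq_zero hx]
      rw [h1, h2, sub_zero, norm_zero]
      have := hW0 x
      positivity
  have hL0pt : ∀ x, ‖conjOp (linWeight τ g) (fun p _ => A p.1 p.2) v x‖ ^ 2
      ≤ 2 * ‖conjOp ψ a v x‖ ^ 2 + 2 * (η * M) ^ 2 * jetSq τ v x := by
    intro x
    by_cases hx : x ∈ tsupport v
    · have h := ((hnear x hx).near_conjOp hφ hv hη0.le hη1 hK hτ hτη hD).2.2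
      rw [← hM, ← mul_assoc] at h
      set y := conjOp ψ a v x
      set z := conjOp (linWeight τ g) (fun p _ => A p.1 p.2) v x
      have h1 : ‖z‖ ≤ ‖y‖ + η * M * √(jetSq τ v x) := by
        calc ‖z‖ = ‖y - (y - z)‖ := by ring_nf
          _ ≤ ‖y‖ + ‖y - z‖ := norm_sub_le _ _
          _ ≤ _ := by gcongr
      have h2 := pow_le_pow_left₀ (norm_nonneg z) h1 2
      have h3 := Real.sq_sqrt (hW0 x)
      nlinarith [sq_nonneg (‖y‖ - η * M * √(jetSq τ v x))]
    · have h1 : ∀ (ψ : E n → ℝ) (a : Fin n × Fin n → E n → ℂ), conjOp ψ a v x = 0 := fun ψ a =>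
        Finset.sum_eq_zero fun p _ => by rw [X_X_eq_zero hx, mul_zero]
      rw [h1, h1]
      have := hW0 x
      rw [norm_zero, zero_pow two_ne_zero, mul_zero, zero_add]
      positivity
  set I := ∫ x, jetSq τ v x with hI
  set L := ∫ x, ‖conjOp ψ a v x‖ ^ 2 with hL
  have hI0 : 0 ≤ I := integral_nonneg hW0
  have hL0 : 0 ≤ L := integral_nonneg fun x => by positivity
  have hLi : Integrable fun x => ‖conjOp ψ a v x‖ ^ 2 :=
    (isTest_conjOp hψ ha hv).integrable_norm_sq
  have h1 : (∫ x, froz x).re ≤ L + η * N / τ * I := by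
    have h2 : (∫ x, comm x).re ≤ L := re_integral_commDensity_le hψ ha hv
    have h3 : ‖∫ x, (froz x - comm x)‖ ≤ ∫ x, η * N / τ * jetSq τ v x :=
      norm_integral_le_of_norm_le (hWi.const_mul _) (ae_of_all _ hpt)
    rw [integral_sub hfrozi hcommi, integral_const_mul] at h3
    have h4 := (re_le_norm _).trans h3
    rw [sub_re] at h4
    linarith
  have h2 : ∫ x, ‖conjOp (linWeight τ g) (fun p _ => A p.1 p.2) v x‖ ^ 2
      ≤ 2 * L + 2 * (η * M) ^ 2 * I := by
    rw [hL, hI, ← integral_const_mul, ← integral_const_mul,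
      ← integral_add (hLi.const_mul _) (hWi.const_mul _)]
    exact integral_mono (isTest_conjOp (contDiff_linWeight τ g)
      (fun _ => contDiff_const) hv).integrable_norm_sq ((hLi.const_mul _).add (hWi.const_mul _))
      hL0pt
  have h3 : I ≤ C * (τ / 2) * (∫ x, froz x).re + C ^ 2 *
      ∫ x, ‖conjOp (linWeight τ g) (fun p _ => A p.1 p.2) v x‖ ^ 2 :=
    integral_jetSq_le_frozen hA hv τ fun ξ => hest ξ τ
  exact le_of_perturbed_le hC hη0.le hη1 hτ1 hI0 hL0 hηB h1 h2 h3

/-- Conjugation with the exponential of the weight turns `D_j` into `X_j`. -/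
theorem X_exp_mul {ψ : E n → ℝ} (hψ : ContDiff ℝ ∞ ψ) {f : E n → ℂ} (hf : IsTest f) (j : Fin n) :
    X ψ j (fun x => (Real.exp (ψ x) : ℂ) * f x) = fun x => (Real.exp (ψ x) : ℂ) * D j f x := by
  ext x
  have hd : Differentiable ℝ ψ := hψ.differentiable (by simp)
  have he : Differentiable ℝ fun x => Real.exp (ψ x) := hd.exp
  have hec : Differentiable ℝ fun x => (Real.exp (ψ x) : ℂ) :=
    (contDiff_ofReal_comp hψ.exp).differentiable (by simp)
  have hpd : pd j (fun x => Real.exp (ψ x)) x = Real.exp (ψ x) * pd j ψ x := by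
    unfold pd
    rw [fderiv_exp (hd x)]
    simp
  simp only [X]
  rw [D_mul hec hf.differentiable, D_ofReal he, hpd]
  push_cast
  ring

/-- The Carleman estimate for smooth coefficients and weight. The closeness to constant data is only
needed on the support of `u`, and the constants do not depend on any further norm of the data. -/
theorem exists_carleman_smooth (n : ℕ) {C K : ℝ} (hC : 1 ≤ C) (hK : 0 ≤ K) :
    ∃ η τ₀ C' : ℝ, 0 < η ∧ 1 ≤ τ₀ ∧ 0 ≤ C' ∧
      ∀ (A : Matrix (Fin n) (Fin n) ℂ) (g : E n) (H : Matrix (Fin n) (Fin n) ℝ),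
        (∀ j l, A j l = A l j) → DataBound K A g H →
        (∀ (ξ : E n) (τ : ℝ), ‖ξ‖ ^ 4 + τ ^ 2 * ‖ξ‖ ^ 2 + τ ^ 4
          ≤ C * (τ ^ 2 * formS A g H ξ τ) + C ^ 2 * ‖symbol A (complexCovector ξ g τ)‖ ^ 2) →
        ∀ (a : Fin n × Fin n → E n → ℂ) (φ : E n → ℝ) (u : E n → ℂ),
          (∀ p, ContDiff ℝ ∞ (a p)) → ContDiff ℝ ∞ φ → IsTest u →
          (∀ x ∈ tsupport u, DataNear η A g H a φ x) →
          ∀ τ : ℝ, τ₀ ≤ τ →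
            ∫ x, jetSq τ u x / τ * Real.exp (2 * τ * φ x)
              ≤ C' * ∫ x, ‖∑ p : Fin n × Fin n, a p x * D p.1 (D p.2 u) x‖ ^ 2
                * Real.exp (2 * τ * φ x) := by
  obtain ⟨η, C', hη0, hη1, hC', hmain⟩ := exists_integral_jetSq_le n hC hK
  set c : ℝ := (Fintype.card (Fin n × Fin n) : ℝ) with hc
  set B : ℝ := c * (20 * (K + 1) ^ 2) ^ 2 + n * (3 * (K + 1)) ^ 2 + 1 with hB
  have hB0 : 0 ≤ B := by positivity
  refine ⟨η, 1 / η, B * C', hη0, by rwa [le_div_iff₀ hη0, one_mul], by positivity, ?_⟩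
  intro A g H hA hD hest a φ u ha hφ hu hnear τ hτ
  have hτ0 : 0 < τ := lt_of_lt_of_le (by positivity) hτ
  have hτη : 1 / τ ≤ η := by
    rw [div_le_iff₀ hη0] at hτ
    rw [div_le_iff₀ hτ0]; linarith
  set ψ : E n → ℝ := fun x => τ * φ x with hψd
  have hψ : ContDiff ℝ ∞ ψ := contDiff_const.mul hφ
  set v : E n → ℂ := fun x => (Real.exp (ψ x) : ℂ) * u x with hvd
  have hexp : ContDiff ℝ ∞ fun x => (Real.exp (ψ x) : ℂ) := contDiff_ofReal_comp hψ.exp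
  have hv : IsTest v := hu.mul_left hexp
  have hsupp : tsupport v ⊆ tsupport u := tsupport_mul_subset_right
  have h1 : ∀ j, X ψ j v = fun x => (Real.exp (ψ x) : ℂ) * D j u x := X_exp_mul hψ hu
  have h2 : ∀ j k, X ψ j (X ψ k v) = fun x => (Real.exp (ψ x) : ℂ) * D j (D k u) x :=
    fun j k => by rw [h1, X_exp_mul hψ (hu.D k)]
  have hsq : ∀ x (z : ℂ), ‖(Real.exp (ψ x) : ℂ) * z‖ ^ 2 = ‖z‖ ^ 2 * Real.exp (2 * τ * φ x) := by
    intro x z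
    rw [norm_mul, norm_real, Real.norm_of_nonneg (Real.exp_pos _).le, mul_pow, ← Real.exp_nat_mul,
      mul_comm]
    congr 2
    simp only [hψd]
    push_cast
    ring
  have hP : ∀ x, ‖conjOp ψ a v x‖ ^ 2
      = ‖∑ p : Fin n × Fin n, a p x * D p.1 (D p.2 u) x‖ ^ 2 * Real.exp (2 * τ * φ x) := by
    intro x
    rw [← hsq]
    congr 2
    simp only [conjOp, h2, Finset.mul_sum]
    exact Finset.sum_congr rfl fun p _ => by ring
  have hest' := hmain A g H hA hD hest a φ v ha hφ hv (fun x hx => hnear x (hsupp hx)) τ hτ0 hτη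
  simp only [← hψd, hP] at hest'
  have hWi := integrable_jetSq hv τ
  -- `e^{τφ} D_j u = X_j v` and `e^{τφ} D_j D_k u = X_j X_k v` are bounded by the jet of `v`.
  have hpt : ∀ x, jetSq τ u x / τ * Real.exp (2 * τ * φ x) ≤ B / τ * jetSq τ v x := by
    intro x
    have hW0 := jetSq_nonneg τ v x
    by_cases hx : x ∈ tsupport u
    · have hK1 : 1 ≤ K + 1 := by linarith
      have hj := jetBound_sqrt_jetSq hτ0 v x
      have hw := (hnear x hx).weightNear hφ hη0.le hη1 hK hτ0 hD
      have b1 : ∀ j, ‖D j u x‖ ^ 2 * Real.exp (2 * τ * φ x)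
          ≤ (3 * (K + 1)) ^ 2 / τ ^ 2 * jetSq τ v x := fun j => by
        have h := (near_X hη0.le hK1 (Real.sqrt_nonneg _) hτ0 hj hw j).1
        have h' := pow_le_pow_left₀ (norm_nonneg _) h 2
        rw [← hψd, h1, hsq, div_pow, mul_pow, Real.sq_sqrt hW0] at h'
        refine h'.trans (le_of_eq (by ring))
      have b2 : ∀ p : Fin n × Fin n, ‖D p.1 (D p.2 u) x‖ ^ 2 * Real.exp (2 * τ * φ x)
          ≤ (20 * (K + 1) ^ 2) ^ 2 * jetSq τ v x := fun p => by
        have h := (near_X_X hη0.le hη1 hK1 (Real.sqrt_nonneg _) hτ0 hτη hψ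
          (contDiff_linWeight τ g) hv hj hw hw p.1 p.2).1
        have h' := pow_le_pow_left₀ (norm_nonneg _) h 2
        rw [← hψd, h2, hsq, mul_pow, Real.sq_sqrt hW0] at h'
        exact h'
      have b0 : ‖u x‖ ^ 2 * Real.exp (2 * τ * φ x) ≤ 1 / τ ^ 4 * jetSq τ v x := by
        have h' := pow_le_pow_left₀ (norm_nonneg _) hj.zero 2
        rw [hvd, hsq, ← hvd, div_pow, Real.sq_sqrt hW0] at h'
        refine h'.trans (le_of_eq (by ring))
      have s1 : (∑ j, ‖D j u x‖ ^ 2) * Real.exp (2 * τ * φ x)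
          ≤ n * ((3 * (K + 1)) ^ 2 / τ ^ 2 * jetSq τ v x) := by
        rw [Finset.sum_mul]
        refine (Finset.sum_le_card_nsmul _ _ _ fun j _ => b1 j).trans (le_of_eq ?_)
        simp
      have s2 : (∑ p : Fin n × Fin n, ‖D p.1 (D p.2 u) x‖ ^ 2) * Real.exp (2 * τ * φ x)
          ≤ c * ((20 * (K + 1) ^ 2) ^ 2 * jetSq τ v x) := by
        rw [Finset.sum_mul]
        refine (Finset.sum_le_card_nsmul _ _ _ fun p _ => b2 p).trans (le_of_eq ?_)
        rw [nsmul_eq_mul, Finset.card_univ]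
      have s1' := mul_le_mul_of_nonneg_left s1 (sq_nonneg τ)
      have s0' := mul_le_mul_of_nonneg_left b0 (show 0 ≤ τ ^ 4 by positivity)
      rw [div_mul_eq_mul_div, div_mul_eq_mul_div]
      refine div_le_div_of_nonneg_right ?_ hτ0.le
      have e1 : τ ^ 2 * (n * ((3 * (K + 1)) ^ 2 / τ ^ 2 * jetSq τ v x))
          = n * (3 * (K + 1)) ^ 2 * jetSq τ v x := by field_simp
      have e0 : τ ^ 4 * (1 / τ ^ 4 * jetSq τ v x) = jetSq τ v x := by field_simp
      rw [e1] at s1'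
      rw [e0] at s0'
      conv_lhs => unfold jetSq
      rw [hB, add_mul, add_mul, add_mul, add_mul, one_mul, mul_assoc (τ ^ 2), mul_assoc (τ ^ 4),
        mul_assoc c]
      exact add_le_add (add_le_add s2 s1') s0'
    · rw [jetSq_eq_zero_of_notMem_tsupport hx, zero_div, zero_mul]
      positivity
  calc ∫ x, jetSq τ u x / τ * Real.exp (2 * τ * φ x)
      ≤ ∫ x, B / τ * jetSq τ v x := by
        refine integral_mono_of_nonneg (ae_of_all _ fun x => ?_) (hWi.const_mul _)
          (ae_of_all _ hpt)
        have := jetSq_nonneg τ u x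
        positivity
    _ = B / τ * ∫ x, jetSq τ v x := integral_const_mul _ _
    _ ≤ B / τ * (C' * τ * ∫ x, ‖∑ p : Fin n × Fin n, a p x * D p.1 (D p.2 u) x‖ ^ 2
          * Real.exp (2 * τ * φ x)) := by gcongr
    _ = _ := by field_simp

/-! ### Approximation by smooth functions -/

theorem exists_bump {r : ℝ} (hr : 0 < r) : ∃ ρ : ContDiffBump (0 : E n), ρ.rOut = r :=
  ⟨⟨r / 2, r, by positivity, by linarith⟩, rfl⟩

theorem contDiff_convolution_bump {F : Type*} [NormedAddCommGroup F] [NormedSpace ℝ F]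
    [CompleteSpace F] (ρ : ContDiffBump (0 : E n)) {f : E n → F} (hf : Continuous f) :
    ContDiff ℝ ∞ (ρ.normed volume ⋆[ContinuousLinearMap.lsmul ℝ ℝ, volume] f) :=
  ρ.hasCompactSupport_normed.contDiff_convolution_left _ ρ.contDiff_normed hf.locallyIntegrable

/-- A Lipschitz function is a uniform limit of smooth functions whose derivatives are bounded by
the Lipschitz constant. -/
theorem exists_smooth_approx_lipschitz {L : ℝ≥0} {f : E n → ℂ} (hf : LipschitzWith L f) {ε : ℝ}
    (hε : 0 < ε) : ∃ f' : E n → ℂ, ContDiff ℝ ∞ f' ∧ (∀ x, ‖f' x - f x‖ ≤ ε) ∧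
      ∀ x, ‖fderiv ℝ f' x‖ ≤ L := by
  obtain ⟨ρ, hρ⟩ := exists_bump (n := n) (r := ε / (L + 1)) (by positivity)
  have hint : ∀ x, Integrable fun t => ρ.normed volume t • f (x - t) := fun x =>
    (ρ.continuous_normed.smul (hf.continuous.comp (by fun_prop))).integrable_of_hasCompactSupport
      (ρ.hasCompactSupport_normed.smul_right)
  refine ⟨_, contDiff_convolution_bump ρ hf.continuous, fun x => ?_, fun x => ?_⟩
  · rw [← dist_eq_norm]
    refine ρ.dist_normed_convolution_le hf.continuous.aestronglyMeasurable fun y hy => ?_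
    rw [hρ, Metric.mem_ball] at hy
    calc dist (f y) (f x) ≤ L * dist y x := hf.dist_le_mul y x
      _ ≤ L * (ε / (L + 1)) := by gcongr
      _ ≤ ε := by
        rw [mul_div_assoc', div_le_iff₀ (by positivity)]
        nlinarith [L.coe_nonneg]
  · refine norm_fderiv_le_of_lipschitz ℝ (LipschitzWith.of_dist_le_mul fun y z => ?_)
    rw [dist_eq_norm, convolution_def, convolution_def]
    simp only [ContinuousLinearMap.lsmul_apply]
    rw [← integral_sub (hint y) (hint z)]
    have hb : ∀ t, ‖ρ.normed volume t • f (y - t) - ρ.normed volume t • f (z - t)‖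
        ≤ ρ.normed volume t * (L * dist y z) := fun t => by
      rw [← smul_sub, norm_smul, Real.norm_of_nonneg (ρ.nonneg_normed t)]
      refine mul_le_mul_of_nonneg_left ?_ (ρ.nonneg_normed t)
      have := hf.dist_le_mul (y - t) (z - t)
      rwa [dist_sub_right, dist_eq_norm] at this
    refine (norm_integral_le_of_norm_le (ρ.integrable_normed.mul_const _)
      (ae_of_all _ hb)).trans (le_of_eq ?_)
    rw [integral_mul_const, ρ.integral_normed, one_mul]

theorem pd_convolution {ρ : ContDiffBump (0 : E n)} {f : E n → ℝ} (hf : ContDiff ℝ 1 f)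
    (hs : HasCompactSupport f) (j : Fin n) :
    pd j (ρ.normed volume ⋆[ContinuousLinearMap.lsmul ℝ ℝ, volume] f)
      = ρ.normed volume ⋆[ContinuousLinearMap.lsmul ℝ ℝ, volume] pd j f := by
  ext x
  have hl : LocallyIntegrable (ρ.normed volume) (volume : Measure (E n)) :=
    ρ.continuous_normed.locallyIntegrable
  unfold pd
  rw [(hs.hasFDerivAt_convolution_right (ContinuousLinearMap.lsmul ℝ ℝ) hl hf x).fderiv,
    convolution_precompR_apply _ hl (hs.fderiv ℝ) (hf.continuous_fderiv (by simp))]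

theorem hasCompactSupport_pd {f : E n → ℝ} (hs : HasCompactSupport f) (j : Fin n) :
    HasCompactSupport (pd j f) := hs.fderiv_apply (𝕜 := ℝ) _

theorem contDiff_pd_of_le {f : E n → ℝ} {k m : WithTop ℕ∞} (hf : ContDiff ℝ k f) (h : m + 1 ≤ k)
    (j : Fin n) : ContDiff ℝ m (pd j f) :=
  (hf.fderiv_right h).clm_apply contDiff_const

theorem eventually_convolution_near {f : E n → ℝ} (hf : Continuous f) (hs : HasCompactSupport f)
    {ε : ℝ} (hε : 0 < ε) : ∀ᶠ r in 𝓝[>] (0 : ℝ), ∀ ρ : ContDiffBump (0 : E n), ρ.rOut = r →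
      ∀ x, |(ρ.normed volume ⋆[ContinuousLinearMap.lsmul ℝ ℝ, volume] f : E n → ℝ) x - f x|
        ≤ ε := by
  have hu : UniformContinuous f := hs.uniformContinuous_of_continuous hf
  obtain ⟨δ, hδ, h⟩ := Metric.uniformContinuous_iff.1 hu ε hε
  filter_upwards [Ioo_mem_nhdsGT hδ] with r hr ρ hρ x
  rw [← Real.dist_eq]
  refine ρ.dist_normed_convolution_le hf.aestronglyMeasurable fun y hy => (h ?_).le
  rw [hρ] at hy
  exact lt_trans hy hr.2

/-- A compactly supported `C²` function is a limit of smooth functions in the `C²` norm. -/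
theorem exists_smooth_approx_contDiff_two {f : E n → ℝ} (hf : ContDiff ℝ 2 f)
    (hs : HasCompactSupport f) {ε : ℝ} (hε : 0 < ε) :
    ∃ f' : E n → ℝ, ContDiff ℝ ∞ f' ∧ (∀ x, |f' x - f x| ≤ ε) ∧
      (∀ x j, |pd j f' x - pd j f x| ≤ ε) ∧
      ∀ x j k, |pd j (pd k f') x - pd j (pd k f) x| ≤ ε := by
  have h1 : ∀ j, ContDiff ℝ 1 (pd j f) := contDiff_pd_of_le hf (by norm_num)
  have h2 : ∀ j k, Continuous (pd j (pd k f)) := fun j k =>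
    (contDiff_pd_of_le (m := 0) (h1 k) (by norm_num) j).continuous
  have s1 : ∀ j, HasCompactSupport (pd j f) := hasCompactSupport_pd hs
  have e0 := eventually_convolution_near hf.continuous hs hε
  have e1 := eventually_all.2 fun j => eventually_convolution_near (h1 j).continuous (s1 j) hε
  have e2 := eventually_all.2 fun j => eventually_all.2 fun k =>
    eventually_convolution_near (h2 j k) (hasCompactSupport_pd (s1 k) j) hε
  obtain ⟨r, ⟨⟨c0, c1⟩, c2⟩, hr⟩ := (((e0.and e1).and e2).and self_mem_nhdsWithin).exists
  obtain ⟨ρ, hρ⟩ := exists_bump (n := n) hr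
  refine ⟨_, contDiff_convolution_bump ρ hf.continuous, c0 ρ hρ, fun x j => ?_, fun x j k => ?_⟩
  · rw [pd_convolution (hf.of_le (by norm_num)) hs]
    exact c1 j ρ hρ x
  · rw [pd_convolution (hf.of_le (by norm_num)) hs, pd_convolution (h1 k) (s1 k)]
    exact c2 j k ρ hρ x

/-! ### Stability under uniform approximation -/

theorem IsTest.integrable_of_eq_zero {u : E n → ℂ} (hu : IsTest u) {f : E n → ℝ}
    (hf : Continuous f) (h0 : ∀ x, x ∉ tsupport u → f x = 0) : Integrable f :=
  hf.integrable_of_hasCompactSupport (HasCompactSupport.intro hu.supp h0)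

theorem IsTest.continuous_jetSq {u : E n → ℂ} (hu : IsTest u) (τ : ℝ) :
    Continuous (jetSq τ u) := by
  unfold jetSq
  exact ((continuous_finsetSum _ fun p _ => ((hu.D _).D _).continuous.norm.pow 2).add
    (continuous_const.mul (continuous_finsetSum _ fun j _ => (hu.D j).continuous.norm.pow 2))).add
    (continuous_const.mul (hu.continuous.norm.pow 2))

theorem IsTest.continuous_sum_mul_D_D {u : E n → ℂ} (hu : IsTest u)
    {a : Fin n × Fin n → E n → ℂ} (ha : ∀ p, Continuous (a p)) :
    Continuous fun x => ∑ p : Fin n × Fin n, a p x * Carleman.D p.1 (Carleman.D p.2 u) x :=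
  continuous_finsetSum _ fun p _ => (ha p).mul ((hu.D _).D _).continuous

theorem norm_sq_le_of_norm_sub_le {z w : ℂ} {ε G : ℝ} (hε : 0 ≤ ε) (hε1 : ε ≤ 1)
    (h : ‖z - w‖ ≤ ε * G) : ‖z‖ ^ 2 ≤ ‖w‖ ^ 2 + ε * (2 * ‖w‖ * G + G ^ 2) := by
  have h1 : ‖z‖ ≤ ‖w‖ + ε * G := by
    calc ‖z‖ = ‖w + (z - w)‖ := by rw [add_sub_cancel]
      _ ≤ _ := (norm_add_le _ _).trans (by gcongr)
  calc ‖z‖ ^ 2 ≤ (‖w‖ + ε * G) ^ 2 := pow_le_pow_left₀ (norm_nonneg _) h1 2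
    _ = ‖w‖ ^ 2 + ε * (2 * ‖w‖ * G) + ε * (ε * G ^ 2) := by ring
    _ ≤ ‖w‖ ^ 2 + ε * (2 * ‖w‖ * G) + ε * (1 * G ^ 2) := by gcongr
    _ = _ := by ring

theorem exp_mul_le_exp_mul_exp {τ s t ε : ℝ} (hτ : 0 < τ) (h : |s - t| ≤ ε) :
    Real.exp (2 * τ * s) ≤ Real.exp (2 * τ * ε) * Real.exp (2 * τ * t) := by
  rw [← Real.exp_add, Real.exp_le_exp]
  have := (abs_le.1 h).2
  nlinarith

/-- The Carleman inequality for fixed `u` and `τ` contains only the values of the coefficients and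
of the weight, hence it is stable under uniform approximation of these. -/
theorem carleman_of_forall_approx {u : E n → ℂ} (hu : IsTest u) {τ C' : ℝ} (hτ : 0 < τ)
    (hC' : 0 ≤ C') {b : Fin n × Fin n → E n → ℂ} {φ : E n → ℝ} (hb : ∀ p, Continuous (b p))
    (hφ : Continuous φ)
    (h : ∀ ε : ℝ, 0 < ε → ∃ (a : Fin n × Fin n → E n → ℂ) (φ' : E n → ℝ),
      (∀ p, Continuous (a p)) ∧ Continuous φ' ∧ (∀ p x, ‖a p x - b p x‖ ≤ ε) ∧
      (∀ x, |φ' x - φ x| ≤ ε) ∧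
      ∫ x, jetSq τ u x / τ * Real.exp (2 * τ * φ' x)
        ≤ C' * ∫ x, ‖∑ p : Fin n × Fin n, a p x * D p.1 (D p.2 u) x‖ ^ 2
          * Real.exp (2 * τ * φ' x)) :
    ∫ x, jetSq τ u x / τ * Real.exp (2 * τ * φ x)
      ≤ C' * ∫ x, ‖∑ p : Fin n × Fin n, b p x * D p.1 (D p.2 u) x‖ ^ 2
        * Real.exp (2 * τ * φ x) := by
  have hexp : ∀ {ψ : E n → ℝ}, Continuous ψ → Continuous fun x => Real.exp (2 * τ * ψ x) :=
    fun hψ => Real.continuous_exp.comp (continuous_const.mul hψ)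
  set G : E n → ℝ := fun x => ∑ p : Fin n × Fin n, ‖D p.1 (D p.2 u) x‖ with hG
  have hGc : Continuous G := continuous_finsetSum _ fun p _ => ((hu.D _).D _).continuous.norm
  have hG0 : ∀ x, x ∉ tsupport u → G x = 0 := fun x hx => by
    simp [hG, D_D_eq_zero_of_notMem_tsupport hx]
  set w : E n → ℂ := fun x => ∑ p : Fin n × Fin n, b p x * D p.1 (D p.2 u) x with hw
  have hwc : Continuous w := hu.continuous_sum_mul_D_D hb
  have hw0 : ∀ x, x ∉ tsupport u → w x = 0 := fun x hx => by
    simp [hw, D_D_eq_zero_of_notMem_tsupport hx]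
  set I₀ := ∫ x, ‖w x‖ ^ 2 * Real.exp (2 * τ * φ x) with hI₀
  set I₁ := ∫ x, (2 * ‖w x‖ * G x + G x ^ 2) * Real.exp (2 * τ * φ x) with hI₁
  have hint0 : Integrable fun x => ‖w x‖ ^ 2 * Real.exp (2 * τ * φ x) :=
    hu.integrable_of_eq_zero ((hwc.norm.pow 2).mul (hexp hφ)) fun x hx => by simp [hw0 x hx]
  have hint1 : Integrable fun x => (2 * ‖w x‖ * G x + G x ^ 2) * Real.exp (2 * τ * φ x) :=
    hu.integrable_of_eq_zero ((((continuous_const.mul hwc.norm).mul hGc).add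
      (hGc.pow 2)).mul (hexp hφ)) fun x hx => by simp [hG0 x hx]
  have hintjet : ∀ {ψ : E n → ℝ}, Continuous ψ →
      Integrable fun x => jetSq τ u x / τ * Real.exp (2 * τ * ψ x) := fun hψ =>
    hu.integrable_of_eq_zero (((hu.continuous_jetSq τ).div_const τ).mul (hexp hψ)) fun x hx => by
      simp [jetSq_eq_zero_of_notMem_tsupport hx]
  have key : ∀ ε ∈ Set.Ioc (0 : ℝ) 1, ∫ x, jetSq τ u x / τ * Real.exp (2 * τ * φ x)
      ≤ Real.exp (2 * τ * ε) * (C' * (Real.exp (2 * τ * ε) * (I₀ + ε * I₁))) := by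
    rintro ε ⟨hε, hε1⟩
    obtain ⟨a, φ', ha, hφ', hab, hφφ', hest⟩ := h ε hε
    have hza : Continuous fun x => ∑ p : Fin n × Fin n, a p x * D p.1 (D p.2 u) x :=
      hu.continuous_sum_mul_D_D ha
    have hstep1 : ∫ x, jetSq τ u x / τ * Real.exp (2 * τ * φ x)
        ≤ Real.exp (2 * τ * ε) * ∫ x, jetSq τ u x / τ * Real.exp (2 * τ * φ' x) := by
      rw [← integral_const_mul]
      refine integral_mono (hintjet hφ) ((hintjet hφ').const_mul _) fun x => ?_
      have h1 := exp_mul_le_exp_mul_exp hτ (by rw [abs_sub_comm]; exact hφφ' x :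
        |φ x - φ' x| ≤ ε)
      calc jetSq τ u x / τ * Real.exp (2 * τ * φ x)
          ≤ jetSq τ u x / τ * (Real.exp (2 * τ * ε) * Real.exp (2 * τ * φ' x)) :=
            mul_le_mul_of_nonneg_left h1 (div_nonneg (jetSq_nonneg _ _ _) hτ.le)
        _ = _ := by ring
    have hstep2 : ∫ x, ‖∑ p : Fin n × Fin n, a p x * D p.1 (D p.2 u) x‖ ^ 2
          * Real.exp (2 * τ * φ' x) ≤ Real.exp (2 * τ * ε) * (I₀ + ε * I₁) := by
      rw [hI₀, hI₁, ← integral_const_mul, ← integral_add hint0 (hint1.const_mul ε),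
        ← integral_const_mul]
      refine integral_mono
        (hu.integrable_of_eq_zero ((hza.norm.pow 2).mul (hexp hφ')) fun x hx => by
          simp [D_D_eq_zero_of_notMem_tsupport hx])
        ((hint0.add (hint1.const_mul ε)).const_mul _) fun x => ?_
      have h1 := exp_mul_le_exp_mul_exp hτ (hφφ' x)
      have h2 : ‖(∑ p : Fin n × Fin n, a p x * D p.1 (D p.2 u) x) - w x‖ ≤ ε * G x := by
        rw [hw, ← Finset.sum_sub_distrib, hG, Finset.mul_sum]
        refine norm_sum_le_of_le _ fun p _ => ?_
        rw [← sub_mul, norm_mul]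
        gcongr
        exact hab p x
      have h3 := norm_sq_le_of_norm_sub_le hε.le hε1 h2
      calc _ ≤ (‖w x‖ ^ 2 + ε * (2 * ‖w x‖ * G x + G x ^ 2))
            * (Real.exp (2 * τ * ε) * Real.exp (2 * τ * φ x)) :=
            mul_le_mul h3 h1 (Real.exp_pos _).le ((sq_nonneg _).trans h3)
        _ = _ := by ring
    exact hstep1.trans (mul_le_mul_of_nonneg_left
      (hest.trans (mul_le_mul_of_nonneg_left hstep2 hC')) (Real.exp_pos _).le)
  have hlim : Tendsto (fun ε : ℝ => Real.exp (2 * τ * ε)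
      * (C' * (Real.exp (2 * τ * ε) * (I₀ + ε * I₁)))) (𝓝[>] 0) (𝓝 (C' * I₀)) := by
    have hc : Continuous fun ε : ℝ => Real.exp (2 * τ * ε)
      * (C' * (Real.exp (2 * τ * ε) * (I₀ + ε * I₁))) := by fun_prop
    have := (hc.tendsto 0).mono_left (nhdsWithin_le_nhds (s := Set.Ioi 0))
    simpa using this
  refine ge_of_tendsto hlim ?_
  filter_upwards [Ioc_mem_nhdsGT (zero_lt_one' ℝ)] with ε hε using key ε hε

/-! ### Localization near the origin -/

/-- The nearest point projection of `ℝⁿ` onto the cube `K_1`. -/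
noncomputable def clamp (x : E n) : E n := WithLp.toLp 2 fun j => max (-1) (min 1 (x j))

theorem clamp_mem_cube (x : E n) : clamp x ∈ cube n 1 := fun j =>
  abs_le.2 ⟨le_max_left _ _, max_le (by norm_num) (min_le_left _ _)⟩

theorem clamp_of_mem_cube {x : E n} (hx : x ∈ cube n 1) : clamp x = x := by
  ext j
  have := abs_le.1 (hx j)
  simp [clamp, this.1, this.2]

theorem lipschitzWith_clamp : LipschitzWith 1 (clamp : E n → E n) := by
  refine LipschitzWith.of_dist_le_mul fun x y => ?_
  rw [NNReal.coe_one, one_mul, EuclideanSpace.dist_eq, EuclideanSpace.dist_eq]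
  refine Real.sqrt_le_sqrt (Finset.sum_le_sum fun j _ => ?_)
  refine pow_le_pow_left₀ dist_nonneg ?_ 2
  have h1 := abs_max_sub_max_le_abs (min 1 (x j)) (min 1 (y j)) (-1)
  have h2 := abs_min_sub_min_le_max 1 (x j) 1 (y j)
  rw [sub_self, abs_zero, max_eq_right (abs_nonneg _)] at h2
  rw [Real.dist_eq, Real.dist_eq]
  simp only [clamp]
  rw [max_comm (-1) (min 1 (x j)), max_comm (-1) (min 1 (y j))]
  exact h1.trans h2

theorem smul_mem_cube {δ : ℝ} (hδ : 0 ≤ δ) (hδ1 : δ ≤ 1) {x : E n} (hx : x ∈ cube n 1) :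
    δ • x ∈ cube n 1 := fun j => by
  have : |(δ • x) j| = δ * |x j| := by
    rw [PiLp.smul_apply, smul_eq_mul, abs_mul, abs_of_nonneg hδ]
  rw [this]
  calc δ * |x j| ≤ 1 * 1 := mul_le_mul hδ1 (hx j) (abs_nonneg _) zero_le_one
    _ = 1 := one_mul 1

theorem norm_lt_of_mem_cube {R r : ℝ} (hR : 0 < R) (hr : (n + 1) * R ≤ r) {x : E n}
    (hx : x ∈ cube n R) : ‖x‖ < r := by
  have h0 : (0 : ℝ) ≤ n := n.cast_nonneg
  refine lt_of_lt_of_le (lt_of_pow_lt_pow_left₀ 2 (by positivity) ?_) hr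
  rw [EuclideanSpace.norm_sq_eq]
  calc ∑ j, ‖x j‖ ^ 2 ≤ ∑ _j : Fin n, R ^ 2 :=
        Finset.sum_le_sum fun j _ => pow_le_pow_left₀ (norm_nonneg _) (hx j) 2
    _ = n * R ^ 2 := by simp
    _ < ((n + 1) * R) ^ 2 := by nlinarith [pow_pos hR 2]

theorem cube_mem_nhds {x : E n} (hx : ‖x‖ < 1) : cube n 1 ∈ 𝓝 x := by
  refine mem_of_superset (Metric.isOpen_ball.mem_nhds (mem_ball_zero_iff.2 hx)) fun y hy j => ?_
  exact (PiLp.norm_apply_le y j).trans (mem_ball_zero_iff.1 hy).le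

/-- Near the origin a function of class `C²` on the cube agrees with a compactly supported function
of class `C²` on the whole space. -/
theorem exists_contDiff_two_extension {φ : E n → ℝ} (hφ : ContDiffOn ℝ 2 φ (cube n 1)) :
    ∃ f : E n → ℝ, ContDiff ℝ 2 f ∧ HasCompactSupport f ∧ ∀ x, ‖x‖ < 1 / 2 → f x = φ x := by
  let χ : ContDiffBump (0 : E n) := ⟨1 / 2, 3 / 4, by norm_num, by norm_num⟩
  refine ⟨fun x => χ x * φ x, contDiff_iff_contDiffAt.2 fun x => ?_,
    χ.hasCompactSupport.mul_right, fun x hx => ?_⟩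
  · by_cases hx : ‖x‖ < 1
    · exact χ.contDiffAt.mul (hφ.contDiffAt (cube_mem_nhds hx))
    · have hx' : x ∉ tsupport χ := by
        rw [χ.tsupport_eq, mem_closedBall_zero_iff]
        change ¬ ‖x‖ ≤ 3 / 4
        linarith
      refine (contDiffAt_const (c := (0 : ℝ))).congr_of_eventuallyEq ?_
      filter_upwards [notMem_tsupport_iff_eventuallyEq.1 hx'] with y hy
      rw [hy, Pi.zero_apply, zero_mul]
  · simp only
    rw [χ.one_of_mem_closedBall (mem_closedBall_zero_iff.2 hx.le), one_mul]

theorem grad_apply_eq {φ f : E n → ℝ} {x : E n} (hx : ‖x‖ < 1) (h : φ =ᶠ[𝓝 x] f) (j : Fin n) :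
    grad φ x j = pd j f x := by
  have h1 : grad φ x j = inner ℝ (grad φ x) (EuclideanSpace.single j 1) := by
    rw [EuclideanSpace.inner_single_right]; simp
  rw [h1, grad, gradientWithin, InnerProductSpace.toDual_symm_apply,
    fderivWithin_of_mem_nhds (cube_mem_nhds hx), h.fderiv_eq]
  rfl

theorem hess_apply_eq {φ f : E n → ℝ} (hf : ContDiff ℝ 2 f) {x : E n} (hx : ‖x‖ < 1)
    (h : φ =ᶠ[𝓝 x] f) (j k : Fin n) : hess φ x j k = pd j (pd k f) x := by
  have hd : DifferentiableAt ℝ (fderiv ℝ f) x :=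
    (hf.fderiv_right (m := 1) (by norm_num)).differentiable (by norm_num) x
  have hc : cube n 1 =ᶠ[𝓝 x] (Set.univ : Set (E n)) :=
    eventuallyEq_univ.2 (cube_mem_nhds hx)
  rw [hess, iteratedFDerivWithin_congr_set hc, iteratedFDerivWithin_univ,
    (h.iteratedFDeriv ℝ 2).eq_of_nhds, iteratedFDeriv_two_apply]
  change fderiv ℝ (fderiv ℝ f) x _ _ = fderiv ℝ (fun y => fderiv ℝ f y _) x _
  rw [fderiv_clm_apply hd (differentiableAt_const _)]
  simp

theorem norm_clm_le_of_apply_single {L : E n →L[ℝ] ℝ} {B : ℝ} (hB : 0 ≤ B)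
    (h : ∀ j, |L (EuclideanSpace.single j 1)| ≤ B) : ‖L‖ ≤ n * B := by
  refine L.opNorm_le_bound (by positivity) fun v => ?_
  have hv : v = ∑ j, v j • EuclideanSpace.single j (1 : ℝ) := by
    ext i
    simp [Pi.single_apply]
  calc ‖L v‖ = ‖∑ j, v j * L (EuclideanSpace.single j 1)‖ := by
        conv_lhs => rw [hv, map_sum]
        simp
    _ ≤ ∑ _j : Fin n, ‖v‖ * B := norm_sum_le_of_le _ fun j _ => by
        rw [norm_mul]
        exact mul_le_mul (PiLp.norm_apply_le v j) (h j) (norm_nonneg _) (norm_nonneg _)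
    _ = n * B * ‖v‖ := by simp; ring

/-- The gradient varies little on a ball on which the Hessian is bounded. -/
theorem abs_pd_sub_le {f : E n → ℝ} (hf : ContDiff ℝ 2 f) {r B : ℝ} (hB : 0 ≤ B)
    (h : ∀ y : E n, ‖y‖ < r → ∀ j k, |pd j (pd k f) y| ≤ B) {x : E n} (hx : ‖x‖ < r) (k : Fin n) :
    |pd k f x - pd k f 0| ≤ n * B * ‖x‖ := by
  have h1 : ContDiff ℝ 1 (pd k f) := contDiff_pd_of_le hf (by norm_num) k
  have := (convex_ball (0 : E n) r).norm_image_sub_le_of_norm_fderiv_le (𝕜 := ℝ) (f := pd k f)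
    (C := n * B) (fun y _ => h1.differentiable (by norm_num) y)
    (fun y hy => norm_clm_le_of_apply_single hB fun j => h y (mem_ball_zero_iff.1 hy) j k)
    (Metric.mem_ball_self ((norm_nonneg x).trans_lt hx)) (mem_ball_zero_iff.2 hx)
  simpa using this

/-- The coefficients `a_{jl}(δx)`, extended to the whole space from the cube. -/
noncomputable def dilatedCoeff (a : E n → Matrix (Fin n) (Fin n) ℂ) (δ : ℝ) (p : Fin n × Fin n)
    (x : E n) : ℂ :=
  a (δ • clamp x) p.1 p.2

theorem lipschitzWith_dilatedCoeff {lam Lam M₀ : ℝ} (hM : 0 ≤ M₀)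
    {a : E n → Matrix (Fin n) (Fin n) ℂ} (ha : AdmissibleCoeff lam Lam M₀ a) {δ : ℝ} (hδ : 0 ≤ δ)
    (hδ1 : δ ≤ 1) (p : Fin n × Fin n) :
    LipschitzWith (Real.toNNReal (M₀ * δ)) (dilatedCoeff a δ p) := by
  refine LipschitzWith.of_dist_le_mul fun x y => ?_
  rw [Real.coe_toNNReal _ (by positivity), dist_eq_norm]
  calc ‖dilatedCoeff a δ p x - dilatedCoeff a δ p y‖
      ≤ M₀ * ‖δ • clamp x - δ • clamp y‖ :=
        ha.lip _ (smul_mem_cube hδ hδ1 (clamp_mem_cube x)) _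
          (smul_mem_cube hδ hδ1 (clamp_mem_cube y)) _ _
    _ = M₀ * (δ * dist (clamp x) (clamp y)) := by
        rw [← smul_sub, norm_smul, Real.norm_of_nonneg hδ, dist_eq_norm]
    _ ≤ M₀ * (δ * dist x y) := by
        have := lipschitzWith_clamp.dist_le_mul x y
        rw [NNReal.coe_one, one_mul] at this
        gcongr
    _ = M₀ * δ * dist x y := by ring

/-- On a small cube, and after a strong dilation of the coefficients, the coefficients and the
weight are uniform limits of smooth data which are close to the frozen data at the origin. -/
theorem exists_dataNear_approx (n : ℕ) {η K M₀ : ℝ} (hη : 0 < η) (hK : 0 ≤ K) (hM : 0 < M₀)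
    {ρ : ℝ → ℝ} (hρ : Tendsto ρ (𝓝[>] 0) (𝓝 0)) :
    ∃ R δ₀ : ℝ, 0 < R ∧ R ≤ 1 ∧ 0 < δ₀ ∧ δ₀ ≤ 1 ∧
      ∀ (lam Lam : ℝ) (a : E n → Matrix (Fin n) (Fin n) ℂ) (φ : E n → ℝ),
        AdmissibleCoeff lam Lam M₀ a → ContDiffOn ℝ 2 φ (cube n 1) →
        (∀ j k, |hess φ 0 j k| ≤ K) →
        (∀ x ∈ cube n 1, x ≠ 0 → ∀ j l, |hess φ x j l - hess φ 0 j l| ≤ ρ ‖x‖) →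
        ∃ f : E n → ℝ, Continuous f ∧ (∀ x ∈ cube n R, f x = φ x) ∧
          ∀ δ : ℝ, 0 < δ → δ ≤ δ₀ → ∀ ε : ℝ, 0 < ε →
          ∃ (a' : Fin n × Fin n → E n → ℂ) (f' : E n → ℝ), (∀ p, ContDiff ℝ ∞ (a' p)) ∧
            ContDiff ℝ ∞ f' ∧ (∀ p x, ‖a' p x - dilatedCoeff a δ p x‖ ≤ ε) ∧
            (∀ x, |f' x - f x| ≤ ε) ∧
            ∀ x ∈ cube n R, DataNear η (a 0) (grad φ 0) (hess φ 0) a' f' x := by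
  -- The radius `r` is chosen such that on the ball of radius `r` the Hessian varies by at most
  -- `min 1 (η / 2)` and hence the gradient by at most `B r ≤ η / 2`.
  obtain ⟨s, hs0, hs⟩ : ∃ s > 0, ∀ t, 0 < t → t < s → ρ t ≤ min 1 (η / 2) := by
    have h := hρ.eventually (ge_mem_nhds (show (0 : ℝ) < min 1 (η / 2) by positivity))
    obtain ⟨s, hs0, hs⟩ := mem_nhdsGT_iff_exists_Ioo_subset.1 h
    exact ⟨s, hs0, fun t h0 h1 => hs ⟨h0, h1⟩⟩
  set B : ℝ := n * (K + 1) with hB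
  have hB0 : 0 ≤ B := by positivity
  set r : ℝ := min (min s (1 / 2)) (η / (2 * (B + 1))) with hr
  have hr0 : 0 < r := by positivity
  have hrs : r ≤ s := (min_le_left _ _).trans (min_le_left _ _)
  have hr2 : r ≤ 1 / 2 := (min_le_left _ _).trans (min_le_right _ _)
  have hrB : B * r ≤ η / 2 := by
    calc B * r ≤ (B + 1) * (η / (2 * (B + 1))) :=
          mul_le_mul (by linarith) (min_le_right _ _) hr0.le (by linarith)
      _ = η / 2 := by field_simp
  have hn0 : (0 : ℝ) ≤ n := n.cast_nonneg
  refine ⟨r / (n + 1), min 1 (η / (2 * M₀)), by positivity, ?_, by positivity, min_le_left _ _, ?_⟩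
  · rw [div_le_iff₀ (by positivity)]; linarith
  intro lam Lam a φ ha hφ hHK hHρ
  have hcube : ∀ x ∈ cube n (r / (n + 1)), ‖x‖ < r := fun x hx =>
    norm_lt_of_mem_cube (by positivity) (by field_simp; rfl) hx
  obtain ⟨f, hf, hfs, hfφ⟩ := exists_contDiff_two_extension hφ
  have hev : ∀ x : E n, ‖x‖ < 1 / 2 → φ =ᶠ[𝓝 x] f := fun x hx => by
    filter_upwards [Metric.isOpen_ball.mem_nhds (mem_ball_zero_iff.2 hx)] with y hy
    exact (hfφ y (mem_ball_zero_iff.1 hy)).symm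
  have hgrad : ∀ x : E n, ‖x‖ < 1 / 2 → ∀ j, grad φ x j = pd j f x := fun x hx =>
    grad_apply_eq (by linarith) (hev x hx)
  have hhess : ∀ x : E n, ‖x‖ < 1 / 2 → ∀ j k, hess φ x j k = pd j (pd k f) x := fun x hx =>
    hess_apply_eq hf (by linarith) (hev x hx)
  have hH : ∀ x : E n, ‖x‖ < r → ∀ j k, |pd j (pd k f) x - hess φ 0 j k| ≤ min 1 (η / 2) := by
    intro x hx j k
    rw [← hhess x (by linarith)]
    rcases eq_or_ne x 0 with rfl | hx0
    · rw [sub_self, abs_zero]; positivity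
    · exact (hHρ x (mem_of_mem_nhds (cube_mem_nhds (by linarith))) hx0 j k).trans
        (hs _ (norm_pos_iff.2 hx0) (by linarith))
  have hHB : ∀ x : E n, ‖x‖ < r → ∀ j k, |pd j (pd k f) x| ≤ K + 1 := fun x hx j k => by
    have h1 := (hH x hx j k).trans (min_le_left _ _)
    have h2 := hHK j k
    rw [abs_le] at *
    constructor <;> linarith [h1.1, h1.2, h2.1, h2.2]
  have hG : ∀ x : E n, ‖x‖ < r → ∀ j, |pd j f x - grad φ 0 j| ≤ η / 2 := fun x hx j => by
    rw [hgrad 0 (by norm_num)]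
    exact (abs_pd_sub_le hf (by linarith) hHB hx j).trans
      ((mul_le_mul_of_nonneg_left hx.le hB0).trans hrB)
  refine ⟨f, hf.continuous, fun x hx => hfφ x (by linarith [hcube x hx]), ?_⟩
  intro δ hδ hδ0 ε hε
  have hδ1 : δ ≤ 1 := hδ0.trans (min_le_left _ _)
  have hMδ : M₀ * δ ≤ η / 2 := by
    calc M₀ * δ ≤ M₀ * (η / (2 * M₀)) :=
          mul_le_mul_of_nonneg_left (hδ0.trans (min_le_right _ _)) hM.le
      _ = η / 2 := by field_simp
  have hlip := lipschitzWith_dilatedCoeff hM.le ha hδ.le hδ1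
  have hε' : 0 < min ε (η / 2) := by positivity
  choose a' ha'1 ha'2 ha'3 using fun p => exists_smooth_approx_lipschitz (hlip p) hε'
  obtain ⟨f', hf'1, hf'2, hf'3, hf'4⟩ := exists_smooth_approx_contDiff_two hf hfs hε'
  refine ⟨a', f', ha'1, hf'1, fun p x => (ha'2 p x).trans (min_le_left _ _),
    fun x => (hf'2 x).trans (min_le_left _ _), fun x hx => ?_⟩
  have hx := hcube x hx
  refine ⟨fun p => ?_, fun p i => ?_, fun j => ?_, fun j k => ?_⟩
  · have h0 : dilatedCoeff a δ p 0 = a 0 p.1 p.2 := by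
      have : clamp (0 : E n) = 0 := clamp_of_mem_cube fun j => by simp
      rw [dilatedCoeff, this, smul_zero]
    have h1 := (hlip p).dist_le_mul x 0
    rw [dist_zero_right, Real.coe_toNNReal _ (by positivity), dist_eq_norm, h0] at h1
    have h2 : M₀ * δ * ‖x‖ ≤ η / 2 * 1 :=
      mul_le_mul hMδ (by linarith) (norm_nonneg _) (by positivity)
    have h3 := (ha'2 p x).trans (min_le_right _ _)
    have h4 := norm_sub_le_norm_sub_add_norm_sub (a' p x) (dilatedCoeff a δ p x) (a 0 p.1 p.2)
    linarith
  · have h1 : ‖D i (a' p) x‖ ≤ ‖fderiv ℝ (a' p) x‖ := by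
      rw [D, norm_mul, norm_neg, norm_I, one_mul]
      exact ((fderiv ℝ (a' p) x).le_opNorm _).trans (by simp)
    have h2 := ha'3 p x
    rw [Real.coe_toNNReal _ (by positivity)] at h2
    linarith
  · have h1 := (hf'3 x j).trans (min_le_right _ _)
    have h2 := hG x hx j
    have h3 := abs_sub_le (pd j f' x) (pd j f x) (grad φ 0 j)
    linarith
  · have h1 := (hf'4 x j k).trans (min_le_right _ _)
    have h2 := (hH x hx j k).trans (min_le_right _ _)
    have h3 := abs_sub_le (pd j (pd k f') x) (pd j (pd k f) x) (hess φ 0 j k)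
    linarith

/-! ### The sum over multi-indices and the compact set of triples -/

theorem iterate_D_eq_foldr (j : Fin n) (k : ℕ) (u : E n → ℂ) :
    (D j)^[k] u = (List.replicate k j).foldr D u := by
  induction k with
  | zero => rfl
  | succ k ih => rw [Function.iterate_succ_apply', ih, List.replicate_succ, List.foldr_cons]

/-- `D^α` is a composition of `|α|` first order operators `D_j`. -/
theorem exists_Dpow_eq_foldr (α : Fin n → ℕ) (u : E n → ℂ) :
    ∃ js : List (Fin n), js.length = ∑ j, α j ∧ Dpow α u = js.foldr D u := by
  have key : ∀ L : List (Fin n), ∃ js : List (Fin n), js.length = (L.map α).sum ∧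
      L.foldr (fun j v => (D j)^[α j] v) u = js.foldr D u := by
    intro L
    induction L with
    | nil => exact ⟨[], rfl, rfl⟩
    | cons j L ih =>
      obtain ⟨js, h1, h2⟩ := ih
      refine ⟨List.replicate (α j) j ++ js, by simp [h1], ?_⟩
      rw [List.foldr_cons, h2, List.foldr_append, iterate_D_eq_foldr]
  obtain ⟨js, h1, h2⟩ := key (List.finRange n)
  exact ⟨js, by rw [h1, Fin.sum_univ_def], h2⟩

/-- Each term of order at most two on the left of the Carleman inequality is controlled by
`jetSq`. -/
theorem zpow_mul_norm_Dpow_sq_le {τ : ℝ} (hτ : 0 < τ) (u : E n → ℂ) {k : ℕ} (hk : k < 3)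
    {α : Fin n → ℕ} (hα : ∑ j, α j = k) (x : E n) :
    τ ^ (3 - 2 * (k : ℤ)) * ‖Dpow α u x‖ ^ 2 ≤ jetSq τ u x / τ := by
  obtain ⟨js, h1, h2⟩ := exists_Dpow_eq_foldr α u
  rw [hα] at h1
  have s2 : 0 ≤ ∑ p : Fin n × Fin n, ‖D p.1 (D p.2 u) x‖ ^ 2 := by positivity
  have s1 : 0 ≤ ∑ j, ‖D j u x‖ ^ 2 := by positivity
  rw [h2, le_div_iff₀ hτ, jetSq]
  interval_cases k
  · obtain rfl := List.length_eq_zero_iff.1 h1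
    have e : τ ^ (3 - 2 * ((0 : ℕ) : ℤ)) = τ ^ 3 := by norm_cast
    rw [e, List.foldr_nil]
    have : 0 ≤ τ ^ 2 * ∑ j, ‖D j u x‖ ^ 2 := by positivity
    nlinarith
  · obtain ⟨j, rfl⟩ := List.length_eq_one_iff.1 h1
    have e : τ ^ (3 - 2 * ((1 : ℕ) : ℤ)) = τ := by norm_num
    rw [e, List.foldr_cons, List.foldr_nil]
    have h := mul_le_mul_of_nonneg_left (Finset.single_le_sum (f := fun j => ‖D j u x‖ ^ 2)
      (fun j _ => by positivity) (Finset.mem_univ j)) (sq_nonneg τ)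
    have : 0 ≤ τ ^ 4 * ‖u x‖ ^ 2 := by positivity
    nlinarith
  · obtain ⟨j, l, rfl⟩ := List.length_eq_two.1 h1
    have e : τ ^ (3 - 2 * ((2 : ℕ) : ℤ)) = τ⁻¹ := by
      rw [← zpow_neg_one]; norm_num
    rw [e, List.foldr_cons, List.foldr_cons, List.foldr_nil]
    have h := Finset.single_le_sum (f := fun p : Fin n × Fin n => ‖D p.1 (D p.2 u) x‖ ^ 2)
      (fun p _ => by positivity) (Finset.mem_univ (j, l))
    have h3 : 0 ≤ τ ^ 4 * ‖u x‖ ^ 2 := by positivity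
    have h4 : 0 ≤ τ ^ 2 * ∑ j, ‖D j u x‖ ^ 2 := by positivity
    have h5 : τ⁻¹ * ‖D j (D l u) x‖ ^ 2 * τ = ‖D j (D l u) x‖ ^ 2 := by field_simp
    rw [h5]
    linarith

theorem IsTest.zpow_mul_integral_norm_Dpow_sq_le {u : E n → ℂ} (hu : IsTest u) {τ : ℝ}
    (hτ : 0 < τ) {φ f : E n → ℝ} (hf : Continuous f) (hfφ : ∀ x ∈ tsupport u, f x = φ x) {k : ℕ}
    (hk : k < 3) {α : Fin n → ℕ} (hα : ∑ j, α j = k) :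
    τ ^ (3 - 2 * (k : ℤ)) * ∫ x, ‖Dpow α u x‖ ^ 2 * Real.exp (2 * τ * φ x)
      ≤ ∫ x, jetSq τ u x / τ * Real.exp (2 * τ * f x) := by
  rw [← integral_const_mul]
  refine integral_mono_of_nonneg (ae_of_all _ fun x => by positivity)
    (hu.integrable_of_eq_zero (((hu.continuous_jetSq τ).div_const τ).mul
      (Real.continuous_exp.comp (continuous_const.mul hf))) fun x hx => by
        simp [jetSq_eq_zero_of_notMem_tsupport hx]) (ae_of_all _ fun x => ?_)
  have h : τ ^ (3 - 2 * (k : ℤ)) * (‖Dpow α u x‖ ^ 2 * Real.exp (2 * τ * φ x))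
      ≤ jetSq τ u x / τ * Real.exp (2 * τ * φ x) := by
    rw [← mul_assoc]
    exact mul_le_mul_of_nonneg_right (zpow_mul_norm_Dpow_sq_le hτ u hk hα x) (Real.exp_pos _).le
  refine h.trans_eq ?_
  by_cases hx : x ∈ tsupport u
  · simp only [hfφ x hx]
  · simp only [jetSq_eq_zero_of_notMem_tsupport hx, zero_div, zero_mul]

theorem sum_dilatedCoeff_eq_P {a : E n → Matrix (Fin n) (Fin n) ℂ} {δ : ℝ} {u : E n → ℂ}
    (hu : tsupport u ⊆ cube n 1) (x : E n) :
    ∑ p : Fin n × Fin n, dilatedCoeff a δ p x * D p.1 (D p.2 u) x = P a δ u x := by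
  rw [P, Fintype.sum_prod_type]
  by_cases hx : x ∈ tsupport u
  · simp only [dilatedCoeff, clamp_of_mem_cube (hu hx)]
  · simp [D_D_eq_zero_of_notMem_tsupport hx]

/-- Passage from `jetSq` to the sum over all multi-indices, and from the extended data to the given
ones. -/
theorem IsTest.sum_integral_norm_Dpow_sq_le {u : E n → ℂ} (hu : IsTest u) {τ C' δ : ℝ}
    (hτ0 : 0 < τ) {φ f : E n → ℝ} (hf : Continuous f) (hfφ : ∀ x ∈ tsupport u, f x = φ x)
    (hu1 : tsupport u ⊆ cube n 1) {a : E n → Matrix (Fin n) (Fin n) ℂ}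
    (hmain : ∫ x, jetSq τ u x / τ * Real.exp (2 * τ * f x)
      ≤ C' * ∫ x, ‖∑ p : Fin n × Fin n,
          dilatedCoeff a δ p x * Carleman.D p.1 (Carleman.D p.2 u) x‖ ^ 2
        * Real.exp (2 * τ * f x)) :
    ∑ k ∈ Finset.range 3, ∑ α ∈ Finset.piAntidiag (Finset.univ : Finset (Fin n)) k,
        τ ^ (3 - 2 * (k : ℤ)) * ∫ x, ‖Dpow α u x‖ ^ 2 * Real.exp (2 * τ * φ x)
      ≤ max 1 ((∑ k ∈ Finset.range 3,
          ((Finset.piAntidiag (Finset.univ : Finset (Fin n)) k).card : ℝ)) * C')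
        * ∫ x, ‖P a δ u x‖ ^ 2 * Real.exp (2 * τ * φ x) := by
  set N : ℝ := ∑ k ∈ Finset.range 3,
    ((Finset.piAntidiag (Finset.univ : Finset (Fin n)) k).card : ℝ) with hN
  have hN0 : 0 ≤ N := Finset.sum_nonneg fun k _ => Nat.cast_nonneg _
  have hP : ∫ x, ‖∑ p : Fin n × Fin n,
      dilatedCoeff a δ p x * Carleman.D p.1 (Carleman.D p.2 u) x‖ ^ 2
      * Real.exp (2 * τ * f x) = ∫ x, ‖P a δ u x‖ ^ 2 * Real.exp (2 * τ * φ x) := by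
    refine integral_congr_ae (Eventually.of_forall fun x => ?_)
    simp only [sum_dilatedCoeff_eq_P hu1]
    by_cases hx : x ∈ tsupport u
    · rw [hfφ x hx]
    · simp [P, D_D_eq_zero_of_notMem_tsupport hx]
  rw [hP] at hmain
  have hI : 0 ≤ ∫ x, ‖P a δ u x‖ ^ 2 * Real.exp (2 * τ * φ x) :=
    integral_nonneg fun x => by positivity
  calc _ ≤ ∑ k ∈ Finset.range 3, ∑ _α ∈ Finset.piAntidiag (Finset.univ : Finset (Fin n)) k,
        ∫ x, jetSq τ u x / τ * Real.exp (2 * τ * f x) :=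
        Finset.sum_le_sum fun k hk => Finset.sum_le_sum fun α hα =>
          hu.zpow_mul_integral_norm_Dpow_sq_le hτ0 hf hfφ
            (Finset.mem_range.1 hk) (Finset.mem_piAntidiag.1 hα).1
    _ = N * ∫ x, jetSq τ u x / τ * Real.exp (2 * τ * f x) := by
        simp only [Finset.sum_const, nsmul_eq_mul, hN, Finset.sum_mul]
    _ ≤ N * (C' * ∫ x, ‖P a δ u x‖ ^ 2 * Real.exp (2 * τ * φ x)) :=
        mul_le_mul_of_nonneg_left hmain hN0
    _ = N * C' * ∫ x, ‖P a δ u x‖ ^ 2 * Real.exp (2 * τ * φ x) := by ring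
    _ ≤ _ := mul_le_mul_of_nonneg_right (le_max_right _ _) hI

theorem zero_mem_cube_one : (0 : E n) ∈ cube n 1 := fun j => by simp

theorem isClosed_forall {X ι : Type*} [TopologicalSpace X] {p : ι → X → Prop}
    (h : ∀ i, IsClosed {x | p i x}) : IsClosed {x | ∀ i, p i x} := by
  have : {x | ∀ i, p i x} = ⋂ i, {x | p i x} := by ext; simp
  rw [this]
  exact isClosed_iInter h

/-- The triples in a compact set whose matrix is symmetric and elliptic with constant `lam` form a
compact set. -/
theorem isCompact_symm_elliptic
    {J : Set (Matrix (Fin n) (Fin n) ℂ × E n × Matrix (Fin n) (Fin n) ℝ)} (hJ : IsCompact J)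
    (lam : ℝ) : IsCompact {t ∈ J | (∀ j l, t.1 j l = t.1 l j) ∧
      ∀ ξ : E n, lam * ‖ξ‖ ^ 2 ≤ ‖symbol t.1 (fun j => (ξ j : ℂ))‖} := by
  have hc : ∀ j l, Continuous fun t : Matrix (Fin n) (Fin n) ℂ × E n × Matrix (Fin n) (Fin n) ℝ =>
    t.1 j l := fun j l => continuous_fst.matrix_elem j l
  refine hJ.inter_right (IsClosed.inter (isClosed_forall fun j => isClosed_forall fun l =>
    isClosed_eq (hc j l) (hc l j)) (isClosed_forall fun ξ => isClosed_le continuous_const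
      (Continuous.norm ?_)))
  exact continuous_finsetSum _ fun j _ => continuous_finsetSum _ fun l _ =>
    ((hc j l).mul continuous_const).mul continuous_const

theorem exists_dataBound {J : Set (Matrix (Fin n) (Fin n) ℂ × E n × Matrix (Fin n) (Fin n) ℝ)}
    (hJ : IsCompact J) : ∃ K, 0 ≤ K ∧ ∀ A g H, (A, g, H) ∈ J → DataBound K A g H := by
  have h1 : ∀ j l, ∃ K, 0 ≤ K ∧ ∀ t ∈ J, ‖t.1 j l‖ ≤ K := fun j l => by
    obtain ⟨K, hK⟩ := hJ.exists_bound_of_continuousOn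
      (continuous_fst.matrix_elem j l).continuousOn
    exact ⟨|K|, abs_nonneg K, fun t ht => (hK t ht).trans (le_abs_self K)⟩
  have h2 : ∀ j, ∃ K, 0 ≤ K ∧ ∀ t ∈ J, |t.2.1 j| ≤ K := fun j => by
    obtain ⟨K, hK⟩ := hJ.exists_bound_of_continuousOn (f := fun t => t.2.1 j)
      (by fun_prop : Continuous fun t : Matrix (Fin n) (Fin n) ℂ × E n ×
        Matrix (Fin n) (Fin n) ℝ => t.2.1 j).continuousOn
    exact ⟨|K|, abs_nonneg K, fun t ht => (hK t ht).trans (le_abs_self K)⟩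
  have h3 : ∀ j l, ∃ K, 0 ≤ K ∧ ∀ t ∈ J, |t.2.2 j l| ≤ K := fun j l => by
    obtain ⟨K, hK⟩ := hJ.exists_bound_of_continuousOn
      ((continuous_snd.comp continuous_snd).matrix_elem j l).continuousOn
    exact ⟨|K|, abs_nonneg K, fun t ht => (hK t ht).trans (le_abs_self K)⟩
  choose K₁ p₁ b₁ using h1
  choose K₂ p₂ b₂ using h2
  choose K₃ p₃ b₃ using h3
  have q₁ : 0 ≤ ∑ j, ∑ l, K₁ j l := Finset.sum_nonneg fun j _ => Finset.sum_nonneg fun l _ => p₁ j l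
  have q₂ : 0 ≤ ∑ j, K₂ j := Finset.sum_nonneg fun j _ => p₂ j
  have q₃ : 0 ≤ ∑ j, ∑ l, K₃ j l := Finset.sum_nonneg fun j _ => Finset.sum_nonneg fun l _ => p₃ j l
  have single : ∀ K : Fin n → Fin n → ℝ, (∀ j l, 0 ≤ K j l) → ∀ j l, K j l ≤ ∑ j, ∑ l, K j l :=
    fun K hK j l => (Finset.single_le_sum (f := K j) (fun l _ => hK j l) (Finset.mem_univ l)).trans
      (Finset.single_le_sum (f := fun j => ∑ l, K j l)
        (fun j _ => Finset.sum_nonneg fun l _ => hK j l) (Finset.mem_univ j))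
  refine ⟨∑ j, ∑ l, K₁ j l + ∑ j, K₂ j + ∑ j, ∑ l, K₃ j l, by linarith, fun A g H h =>
    ⟨fun j l => ?_, fun j => ?_, fun j l => ?_⟩⟩
  · linarith [b₁ j l _ h, single K₁ p₁ j l]
  · linarith [b₂ j _ h, Finset.single_le_sum (f := K₂) (fun j _ => p₂ j) (Finset.mem_univ j)]
  · linarith [b₃ j l _ h, single K₃ p₃ j l]

end Carleman

theorem mainTheorem2 (n : ℕ) (lam Lam M₀ : ℝ) (hlam : 0 < lam) (hLam : 0 < Lam) (hM₀ : 0 < M₀)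
    (J : Set (Matrix (Fin n) (Fin n) ℂ × Carleman.E n × Matrix (Fin n) (Fin n) ℝ))
    (hJ : IsCompact J)
    (hSP : ∀ A g H, (A, g, H) ∈ J → Carleman.StrongPseudoconvex A g H)
    (ω : ℝ → ℝ) (hω : Filter.Tendsto ω (nhdsWithin 0 (Set.Ioi 0)) (nhds 0)) :
    ∃ R δ₀ C₀ τ₀ : ℝ, (0 < R ∧ R ≤ 1) ∧ (0 < δ₀ ∧ δ₀ ≤ 1) ∧ 1 ≤ C₀ ∧ 1 ≤ τ₀ ∧
      ∀ (a : Carleman.E n → Matrix (Fin n) (Fin n) ℂ) (φ : Carleman.E n → ℝ),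
        Carleman.AdmissibleCoeff lam Lam M₀ a →
        ContDiffOn ℝ 2 φ (Carleman.cube n 1) →
        (∀ x ∈ Carleman.cube n 1, Carleman.grad φ x ≠ 0) →
        (a 0, Carleman.grad φ 0, Carleman.hess φ 0) ∈ J →
        (∀ x ∈ Carleman.cube n 1, x ≠ 0 →
          ∀ j l, |Carleman.hess φ x j l - Carleman.hess φ 0 j l| ≤ ω ‖x‖) →
        ∀ u : Carleman.E n → ℂ, ContDiff ℝ (⊤ : ℕ∞) u → HasCompactSupport u →
          tsupport u ⊆ interior (Carleman.cube n R) →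
        ∀ τ : ℝ, τ₀ ≤ τ → ∀ δ : ℝ, 0 < δ → δ ≤ δ₀ →
          ∑ k ∈ Finset.range 3, ∑ α ∈ Finset.piAntidiag (Finset.univ : Finset (Fin n)) k,
              τ ^ (3 - 2 * (k : ℤ)) *
                ∫ x, ‖Carleman.Dpow α u x‖ ^ 2 * Real.exp (2 * τ * φ x)
            ≤ C₀ * ∫ x, ‖Carleman.P a δ u x‖ ^ 2 * Real.exp (2 * τ * φ x) := by
  open Carleman in
  -- The triples of `J` that admissible coefficients can attain; symmetry and ellipticity of the
  -- others are not known.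
  have hJ' := isCompact_symm_elliptic hJ lam
  obtain ⟨C, hC, hsymbol⟩ := exists_symbol_estimate hlam hJ' (fun A g H h => hSP A g H h.1)
    (fun A g H h => h.2.1) (fun A g H h => h.2.2)
  obtain ⟨K, hK, hbound⟩ := exists_dataBound hJ'
  obtain ⟨η, τ₀, C', hη, hτ₀, hC', hcarl⟩ := exists_carleman_smooth n hC hK
  obtain ⟨R, δ₀, hR, hR1, hδ₀, hδ₀1, happrox⟩ := exists_dataNear_approx n hη hK hM₀ hω
  -- The number of multi-indices enters because each of them is bounded by the full jet.
  refine ⟨R, δ₀, max 1 ((∑ k ∈ Finset.range 3,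
    ((Finset.piAntidiag (Finset.univ : Finset (Fin n)) k).card : ℝ)) * C'), τ₀,
    ⟨hR, hR1⟩, ⟨hδ₀, hδ₀1⟩, le_max_left _ _, hτ₀, ?_⟩
  intro a φ ha hφ _ hmem hHω u hu hus huR τ hτ δ hδ hδδ
  have hτ0 : 0 < τ := by linarith
  have hcR : cube n R ⊆ cube n 1 := fun x hx j => (hx j).trans hR1
  have huR' : tsupport u ⊆ cube n R := huR.trans interior_subset
  have htest : IsTest u := ⟨hu, hus⟩
  have h0 : (0 : E n) ∈ cube n 1 := zero_mem_cube_one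
  have hmem' : (a 0, grad φ 0, hess φ 0) ∈ {t ∈ J | (∀ j l, t.1 j l = t.1 l j) ∧
      ∀ ξ : E n, lam * ‖ξ‖ ^ 2 ≤ ‖symbol t.1 (fun j => (ξ j : ℂ))‖} :=
    ⟨hmem, ha.symm 0 h0, ha.elliptic 0 h0⟩
  have hB := hbound _ _ _ hmem'
  obtain ⟨f, hf, hfφ, hdata⟩ := happrox lam Lam a φ ha hφ hB.hess hHω
  have hmain := carleman_of_forall_approx htest hτ0 hC' (b := dilatedCoeff a δ)
    (fun p => (lipschitzWith_dilatedCoeff hM₀.le ha hδ.le (hδδ.trans hδ₀1) p).continuous) hf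
    fun ε hε => by
      obtain ⟨a', f', h1, h2, h3, h4, h5⟩ := hdata δ hδ hδδ ε hε
      exact ⟨a', f', fun p => (h1 p).continuous, h2.continuous, h3, h4,
        hcarl _ _ _ (ha.symm 0 h0) hB (hsymbol _ _ _ hmem') a' f' u h1 h2 htest
          (fun x hx => h5 x (huR' hx)) τ hτ⟩
  exact htest.sum_integral_norm_Dpow_sq_le hτ0 hf (fun x hx => hfφ x (huR' hx)) (huR'.trans hcR)
    hmain
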